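/- For integers $0\le m\le N$ and a classical reversible circuit $C:\{0,1\}^N\to\{0,1\}^N$ (a sequence of multiply controlled NOT gates, such as $X$, CNOT and Toffoli), the HC$m$Q circuit of $C$ on $N$ qubits prepares the state $$(H^{\otimes(N-m)}\otimes I^{\otimes m})\,C\,(H^{\otimes(N-m)}\otimes I^{\otimes m})\,|0^N\rangle ,$$ where $H$ is the Hadamard gate and $C$ acts coherently by $|w\rangle\mapsto|C(w)\rangle$, and then measures all $N$ qubits in the computational basis. Let $(C_{N,m})_{0\le m\le N}$ be a polynomial-time uniformly generated family of such circuits, that is, a deterministic classical algorithm outputs the description of $C_{N,m}$ on input $(1^N,1^m)$ in time polynomial in $N$. Then the probability distribution of the measurement results on any $O(\log N)$ qubits can be classically sampled in polynomial time within a $1/\mathrm{poly}(N)$ error in the $L^1$ norm. Precisely: for every function $k(N)=O(\log N)$ and every polynomial $r$ with natural-number coefficients that is positive at every natural number, there is a classical probabilistic algorithm, running in time polynomial in $N$ on the inputs below, such that for all $0\le m\le N$ and every set $S\subseteq\{1,\dots,N\}$ of $\kappa=|S|\le k(N)$ qubits, on input $(1^N,1^m,S)$ it outputs $z\in\{0,1\}^{\kappa}$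 with probabilities $q_z$ satisfying $$\sum_{z\in\{0,1\}^{\kappa}}|p_z-q_z|\le\frac1{r(N)},$$ where $p_z$ is the probability that the measurement of the qubits in $S$ gives the result $z$ in the HC$m$Q circuit of $C_{N,m}$. -/

import Mathlib

open Asymptotics Filter

namespace HCmQ

/-- Bit strings of length `n`. -/
abbrev Bits (n : ℕ) : Type := Fin n → Bool

/-! ### Classical polynomial-time computation: deterministic multi-stack bit machines -/

/-- Programs of a machine with finitely many stacks of bits (a program mentions only finitely many
of the stacks, which are named by natural numbers). -/
inductive Program : Type
  /-- do nothing -/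
  | nop : Program
  /-- push the bit `b` onto the stack `r` -/
  | push (r : ℕ) (b : Bool) : Program
  /-- remove the top bit of the stack `r` (no effect if it is empty) -/
  | pop (r : ℕ) : Program
  /-- run the first program, then the second one -/
  | seq (c d : Program) : Program
  /-- inspect the stack `r`: run `c₁` if its top bit is 1, `c₀` if its top bit is 0, and `ce` if
  it is empty -/
  | branch (r : ℕ) (c₁ c₀ ce : Program) : Program
  /-- repeat `c` as long as the stack `r` is not empty -/
  | loop (r : ℕ) (c : Program) : Program

/-- The contents of the stacks; the top of a stack is the head of the list. -/
abbrev Store : Type := ℕ → List Bool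

/-- `Exec c s t s'`: started in the store `s`, the program `c` halts after exactly `t` elementary
steps (each push, pop, `nop` and inspection of the top of a stack is one step) in the store `s'`. -/
inductive Exec : Program → Store → ℕ → Store → Prop
  | nop (s : Store) : Exec .nop s 1 s
  | push (r : ℕ) (b : Bool) (s : Store) :
      Exec (.push r b) s 1 (Function.update s r (b :: s r))
  | pop (r : ℕ) (s : Store) : Exec (.pop r) s 1 (Function.update s r (s r).tail)
  | seq {c d : Program} {s s' s'' : Store} {t t' : ℕ} :
      Exec c s t s' → Exec d s' t' s'' → Exec (.seq c d) s (t + t') s''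
  | branchOne {r : ℕ} {c₁ c₀ ce : Program} {s s' : Store} {t : ℕ} :
      (s r).head? = some true → Exec c₁ s t s' → Exec (.branch r c₁ c₀ ce) s (t + 1) s'
  | branchZero {r : ℕ} {c₁ c₀ ce : Program} {s s' : Store} {t : ℕ} :
      (s r).head? = some false → Exec c₀ s t s' → Exec (.branch r c₁ c₀ ce) s (t + 1) s'
  | branchEmpty {r : ℕ} {c₁ c₀ ce : Program} {s s' : Store} {t : ℕ} :
      s r = [] → Exec ce s t s' → Exec (.branch r c₁ c₀ ce) s (t + 1) s'
  | loopDone {r : ℕ} {c : Program} {s : Store} :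
      s r = [] → Exec (.loop r c) s 1 s
  | loopStep {r : ℕ} {c : Program} {s s' s'' : Store} {t t' : ℕ} :
      s r ≠ [] → Exec c s t s' → Exec (.loop r c) s' t' s'' →
        Exec (.loop r c) s (t + t' + 1) s''

/-- The initial store: the input words on the stacks `0, 1, 2, …`, all other stacks empty. -/
def initStore (inputs : List (List Bool)) : Store := fun r => inputs.getD r []

/-- On the given input words the program halts within `T` steps with the word `out` on stack 0. -/
def Program.ComputesInTime (c : Program) (inputs : List (List Bool)) (out : List Bool) (T : ℕ) :
    Prop :=
  ∃ (t : ℕ) (s : Store), t ≤ T ∧ Exec c (initStore inputs) t s ∧ s 0 = out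

/-- The unary word `1ⁿ`. -/
def unary (n : ℕ) : List Bool := List.replicate n true

/-- The word formed by a bit string. -/
def word {n : ℕ} (x : Bits n) : List Bool := List.ofFn x

/-- The characteristic word, of length `N`, of a set of qubits. -/
def setWord {N : ℕ} (S : Finset (Fin N)) : List Bool := word fun i => decide (i ∈ S)

/-- The probability that `F ρ = z` when `ρ` is a uniformly random string of `p` coin flips. -/
noncomputable def coinProb {p k : ℕ} (F : Bits p → Bits k) (z : Bits k) : ℝ :=
  ((Finset.univ.filter fun ρ => F ρ = z).card : ℝ) / 2 ^ p

/-! ### Classical reversible circuits -/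

/-- A classical reversible gate on `N` bits: flip the bit `target` if all bits in `controls` are 1
(with 0, 1, 2 controls these are the gates `X`, `CNOT` and Toffoli). -/
structure Gate (N : ℕ) where
  /-- the controlling bits -/
  controls : Finset (Fin N)
  /-- the bit that is flipped -/
  target : Fin N
  /-- the target is not a control -/
  target_notMem : target ∉ controls

/-- The action of a gate on bit strings. -/
def Gate.apply {N : ℕ} (g : Gate N) (w : Bits N) : Bits N :=
  if ∀ i ∈ g.controls, w i = true then Function.update w g.target (!w g.target) else w

theorem Gate.apply_involutive {N : ℕ} (g : Gate N) : Function.Involutive g.apply := by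
  intro w
  by_cases h : ∀ i ∈ g.controls, w i = true
  · have h' : ∀ i ∈ g.controls, Function.update w g.target (!w g.target) i = true := by
      intro i hi
      have hne : i ≠ g.target := fun e => g.target_notMem (e ▸ hi)
      rw [Function.update_of_ne hne]
      exact h i hi
    have e : g.apply w = Function.update w g.target (!w g.target) := if_pos h
    rw [e, Gate.apply, if_pos h']
    simp
  · have e : g.apply w = w := if_neg h
    rw [e, e]

/-- The permutation of `{0,1}^N` effected by a gate. -/
def Gate.perm {N : ℕ} (g : Gate N) : Equiv.Perm (Bits N) := g.apply_involutive.toPerm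

/-- A classical reversible circuit on `N` bits: the list of its gates, the first one acting first. -/
abbrev Circuit (N : ℕ) : Type := List (Gate N)

/-- The permutation `C : {0,1}^N → {0,1}^N` computed by a circuit. -/
def Circuit.perm {N : ℕ} : Circuit N → Equiv.Perm (Bits N)
  | [] => Equiv.refl _
  | g :: C => g.perm.trans (Circuit.perm C)

/-- The description of a gate as a word of length `2N`: for every bit `i` in turn, whether it is
a control, and whether it is the target. -/
def Gate.encode {N : ℕ} (g : Gate N) : List Bool :=
  (List.finRange N).flatMap fun i => [decide (i ∈ g.controls), decide (i = g.target)]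

/-- The description of a circuit as a word: the descriptions of its gates one after the other. -/
def Circuit.encode {N : ℕ} (C : Circuit N) : List Bool := List.flatMap Gate.encode C

/-- Polynomial-time uniformly generated circuits `C N m` for the HC`m`Q model on `N ≥ m` qubits:
one program computes the description of `C N m` from `1^N` and `1^m` in time polynomial in `N`. -/
def PolyTimeUniform (C : (N m : ℕ) → Circuit N) : Prop :=
  ∃ (G : Program) (T : Polynomial ℕ), ∀ N m : ℕ, m ≤ N →
    G.ComputesInTime [unary N, unary m] (C N m).encode (T.eval N)

/-! ### The HC`m`Q model -/

/-- The Hadamard gate `H`. -/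
noncomputable def hadamard : Matrix Bool Bool ℂ :=
  Matrix.of fun a b => (if a && b then -1 else 1) / (Real.sqrt 2 : ℂ)

/-- The matrix of `H^{⊗(N-m)} ⊗ I^{⊗m}` in the computational basis of `N` qubits. -/
noncomputable def hadamardLayer (N m : ℕ) : Matrix (Bits N) (Bits N) ℂ :=
  Matrix.of fun v w =>
    ∏ i : Fin N, (if (i : ℕ) < N - m then hadamard else (1 : Matrix Bool Bool ℂ)) (v i) (w i)

/-- The coherent application `|w⟩ ↦ |C(w)⟩` of a classical reversible circuit. -/
def Circuit.unitary {N : ℕ} (C : Circuit N) : Matrix (Bits N) (Bits N) ℂ :=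
  Matrix.of fun v w => if v = C.perm w then 1 else 0

/-- The state `(H^{⊗(N-m)} ⊗ I^{⊗m}) C (H^{⊗(N-m)} ⊗ I^{⊗m}) |0^N⟩`. -/
noncomputable def finalState {N : ℕ} (m : ℕ) (C : Circuit N) : Bits N → ℂ :=
  (hadamardLayer N m).mulVec (C.unitary.mulVec ((hadamardLayer N m).mulVec
    (Pi.single (fun _ => false) 1)))

/-- The probability of the outcome `w` when all `N` qubits are measured. -/
noncomputable def outputProb {N : ℕ} (m : ℕ) (C : Circuit N) (w : Bits N) : ℝ :=
  ‖finalState m C w‖ ^ 2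

/-- The results on the qubits of `S`, in increasing order of the qubits. -/
def readout {N : ℕ} (S : Finset (Fin N)) (w : Bits N) : Bits S.card :=
  fun j => w (S.orderEmbOfFin rfl j)

/-- The probability of the measurement result `z` on the qubits of `S`. -/
noncomputable def marginalProb {N : ℕ} (m : ℕ) (C : Circuit N) (S : Finset (Fin N))
    (z : Bits S.card) : ℝ :=
  ∑ w ∈ Finset.univ.filter fun w => readout S w = z, outputProb m C w

end HCmQ

/-! After the first Hadamard layer and `C`, the register is in the uniform superposition over the
set A of images under `C` of the strings whose last m bits are 0. The statistics on S do not change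
if every qubit that lies outside S, or has no final Hadamard gate, is measured right after `C`. This
picks u uniformly from A and leaves, on the a qubits of S with Hadamard gates, the uniform
superposition of the masks T with u ⊕ T in A. The final Hadamard gates turn amplitudes into Walsh
coefficients: the outcome ζ has probability W_u(ζ)² / (2^a c_u), where c_u is the number of these
masks.

All of this is classical work of polynomial size. The string u is `C` applied to a random input. As
a ≤ k(N) = O(log N), there are polynomially many masks; membership in A is tested by running the
reversible circuit backwards, so the integers W_u(ζ)² are found exactly. By Parseval
(`sum_walsh_sq`) they add up to 2^a c_u, a positive integer of size at most 4^N. The mixture over u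
is exactly the quantum distribution (`marginalProb_eq`). The only error comes from choosing ζ with
an l-bit random number reduced modulo the total, and it is at most 4^N / 2^l
(`sum_abs_marginalProb_sub_le`).

The measurement argument is carried out by summation. `marginalProb_readout` expands the squared
amplitudes into a sum over pairs of basis states and obtains a linear average of Walsh coefficients
over A; `sum_walsh_eq` turns it into an average of squares by shifting along the cosets of the
masks.

For the running time, `Comp` describes families of words, indexed by instances, that one program
computes in polynomial time. It is closed under case distinction (`Comp.ite`), bounded iteration
(`Comp.iter_length`) and subroutine calls (`Comp.call`). A loop body is again such a family, over
the instances paired with a step number, so nested loops need no further reasoning about machines.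
Numbers are kept in unary, so a number is computable only if its value is polynomially bounded. -/

namespace HCmQ

/-! ### Polynomially bounded families -/

/-- The family `g` of numbers is bounded by a polynomial in the size `M` of the instance. -/
def PolyBounded {ι : Type} (M g : ι → ℕ) : Prop := ∃ K : ℕ, ∀ i, g i ≤ (M i + 2) ^ K

namespace PolyBounded

variable {ι : Type} {M g h : ι → ℕ}

theorem mono (hh : PolyBounded M h) (hg : ∀ i, g i ≤ h i) : PolyBounded M g := by
  obtain ⟨K, hK⟩ := hh
  exact ⟨K, fun i => (hg i).trans (hK i)⟩

theorem self : PolyBounded M M := ⟨1, fun i => by simp⟩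

/-- The base `M i + 2` is at least 2 even for instances of size 0, so the exponent `n` itself is
large enough. -/
theorem const (n : ℕ) : PolyBounded M fun _ => n :=
  ⟨n, fun i => (Nat.lt_pow_self (by omega)).le⟩

theorem add (hg : PolyBounded M g) (hh : PolyBounded M h) : PolyBounded M fun i => g i + h i := by
  obtain ⟨K, hK⟩ := hg
  obtain ⟨K', hK'⟩ := hh
  -- The extra factor `M i + 2 ≥ 2` absorbs the sum of the two powers.
  refine ⟨K + K' + 1, fun i => ?_⟩
  have h1 : (M i + 2) ^ K ≤ (M i + 2) ^ (K + K') := Nat.pow_le_pow_right (by omega) (by omega)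
  have h2 : (M i + 2) ^ K' ≤ (M i + 2) ^ (K + K') := Nat.pow_le_pow_right (by omega) (by omega)
  rw [pow_succ]
  nlinarith [hK i, hK' i]

theorem mul (hg : PolyBounded M g) (hh : PolyBounded M h) : PolyBounded M fun i => g i * h i := by
  obtain ⟨K, hK⟩ := hg
  obtain ⟨K', hK'⟩ := hh
  exact ⟨K + K', fun i => by rw [pow_add]; exact Nat.mul_le_mul (hK i) (hK' i)⟩

theorem comp {ι' : Type} (hg : PolyBounded M g) (π : ι' → ι) :
    PolyBounded (fun p => M (π p)) fun p => g (π p) := by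
  obtain ⟨K, hK⟩ := hg
  exact ⟨K, fun p => hK (π p)⟩

end PolyBounded

/-! ### Execution of programs -/

/-- The program with all stacks renamed by `φ`. -/
def Program.rename (φ : ℕ → ℕ) : Program → Program
  | .nop => .nop
  | .push r b => .push (φ r) b
  | .pop r => .pop (φ r)
  | .seq c d => .seq (c.rename φ) (d.rename φ)
  | .branch r c₁ c₀ ce => .branch (φ r) (c₁.rename φ) (c₀.rename φ) (ce.rename φ)
  | .loop r c => .loop (φ r) (c.rename φ)

/-- Relocates a program to other stacks. Injectivity keeps stacks from colliding; the last clause is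
the frame property that protects the data of the surrounding program. -/
theorem Exec.rename {c : Program} {s s' : Store} {t : ℕ} (h : Exec c s t s') {φ : ℕ → ℕ}
    (hφ : Function.Injective φ) : ∀ S : Store, (∀ r, S (φ r) = s r) →
      ∃ S' : Store, Exec (c.rename φ) S t S' ∧ (∀ r, S' (φ r) = s' r) ∧
        ∀ x, x ∉ Set.range φ → S' x = S x := by
  induction h with
  | nop s => exact fun S hS => ⟨S, .nop S, hS, fun _ _ => rfl⟩
  | push r b s =>
    refine fun S hS => ⟨_, .push (φ r) b S, fun q => ?_, fun x hx => ?_⟩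
    · by_cases e : q = r
      · subst e; simp [hS]
      · rw [Function.update_of_ne (fun h => e (hφ h)), Function.update_of_ne e, hS]
    · exact Function.update_of_ne (fun h => hx ⟨r, h.symm⟩) _ _
  | pop r s =>
    refine fun S hS => ⟨_, .pop (φ r) S, fun q => ?_, fun x hx => ?_⟩
    · by_cases e : q = r
      · subst e; simp [hS]
      · rw [Function.update_of_ne (fun h => e (hφ h)), Function.update_of_ne e, hS]
    · exact Function.update_of_ne (fun h => hx ⟨r, h.symm⟩) _ _
  | seq _ _ ih1 ih2 =>
    intro S hS
    obtain ⟨S1, e1, h1, f1⟩ := ih1 S hS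
    obtain ⟨S2, e2, h2, f2⟩ := ih2 S1 h1
    exact ⟨S2, .seq e1 e2, h2, fun x hx => (f2 x hx).trans (f1 x hx)⟩
  | branchOne hr _ ih =>
    intro S hS
    obtain ⟨S1, e1, h1, f1⟩ := ih S hS
    exact ⟨S1, .branchOne (by rw [hS, hr]) e1, h1, f1⟩
  | branchZero hr _ ih =>
    intro S hS
    obtain ⟨S1, e1, h1, f1⟩ := ih S hS
    exact ⟨S1, .branchZero (by rw [hS, hr]) e1, h1, f1⟩
  | branchEmpty hr _ ih =>
    intro S hS
    obtain ⟨S1, e1, h1, f1⟩ := ih S hS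
    exact ⟨S1, .branchEmpty (by rw [hS, hr]) e1, h1, f1⟩
  | loopDone hr => exact fun S hS => ⟨S, .loopDone (by rw [hS, hr]), hS, fun _ _ => rfl⟩
  | loopStep hr _ _ ih1 ih2 =>
    intro S hS
    obtain ⟨S1, e1, h1, f1⟩ := ih1 S hS
    obtain ⟨S2, e2, h2, f2⟩ := ih2 S1 h1
    exact ⟨S2, .loopStep (by rwa [hS]) e1 e2, h2, fun x hx => (f2 x hx).trans (f1 x hx)⟩

/-- One step pushes at most one bit. Hence time bounds are also bounds for the lengths of results.
-/
theorem Exec.length_le {c : Program} {s s' : Store} {t : ℕ} (h : Exec c s t s') (r : ℕ) :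
    (s' r).length ≤ (s r).length + t := by
  induction h with
  | nop s => omega
  | push q b s => by_cases e : r = q <;> simp [e]
  | pop q s => by_cases e : r = q <;> simp [e]; omega
  | seq _ _ ih1 ih2 => omega
  | branchOne _ _ ih => omega
  | branchZero _ _ ih => omega
  | branchEmpty _ _ ih => omega
  | loopDone _ => omega
  | loopStep _ _ _ ih1 ih2 => omega

/-- A bound for the stacks that a program mentions. -/
def Program.bound : Program → ℕ
  | .nop => 0
  | .push r _ => r + 1
  | .pop r => r + 1
  | .seq c d => max c.bound d.bound
  | .branch _ c₁ c₀ ce => max c₁.bound (max c₀.bound ce.bound)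
  | .loop _ c => c.bound

/-- Only pushes and pops count in `Program.bound`, as inspecting a stack does not change it. So
finitely many stacks have to be cleaned up after a subroutine. -/
theorem Exec.eq_of_bound_le {c : Program} {s s' : Store} {t : ℕ} (h : Exec c s t s') {r : ℕ}
    (hr : c.bound ≤ r) : s' r = s r := by
  induction h with
  | nop s => rfl
  | push q b s => exact Function.update_of_ne (by simp only [Program.bound] at hr; omega) _ _
  | pop q s => exact Function.update_of_ne (by simp only [Program.bound] at hr; omega) _ _
  | seq _ _ ih1 ih2 =>
    simp only [Program.bound, max_le_iff] at hr
    rw [ih2 hr.2, ih1 hr.1]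
  | branchOne _ _ ih => simp only [Program.bound, max_le_iff] at hr; exact ih hr.1
  | branchZero _ _ ih => simp only [Program.bound, max_le_iff] at hr; exact ih hr.2.1
  | branchEmpty _ _ ih => simp only [Program.bound, max_le_iff] at hr; exact ih hr.2.2
  | loopDone _ => rfl
  | loopStep _ _ _ ih1 ih2 => rw [ih2 hr, ih1 hr]

/-- The program `c` leads from the store `s` to the store `s'` in at most `T` steps. -/
def Runs (c : Program) (s : Store) (T : ℕ) (s' : Store) : Prop := ∃ t ≤ T, Exec c s t s'

namespace Runs

variable {c d : Program} {s s' s'' : Store} {T T' : ℕ}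

theorem mono (h : Runs c s T s') (hT : T ≤ T') : Runs c s T' s' := by
  obtain ⟨t, ht, e⟩ := h
  exact ⟨t, ht.trans hT, e⟩

theorem congr (h : Runs c s T s') (hT : T ≤ T') (hs : s' = s'') : Runs c s T' s'' :=
  hs ▸ h.mono hT

theorem nop : Runs .nop s 1 s := ⟨1, le_rfl, .nop s⟩

theorem push (r : ℕ) (b : Bool) : Runs (.push r b) s 1 (Function.update s r (b :: s r)) :=
  ⟨1, le_rfl, .push r b s⟩

theorem pop (r : ℕ) : Runs (.pop r) s 1 (Function.update s r (s r).tail) :=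
  ⟨1, le_rfl, .pop r s⟩

theorem seq (h : Runs c s T s') (h' : Runs d s' T' s'') : Runs (.seq c d) s (T + T') s'' := by
  obtain ⟨t, ht, e⟩ := h
  obtain ⟨t', ht', e'⟩ := h'
  exact ⟨t + t', by omega, .seq e e'⟩

/-- The loop invariant is given as the exact store `σ j` before round `j`. Each round pays one extra
step for the test, and the failing test at the end pays the last one. -/
theorem loop {r n : ℕ} {σ : ℕ → Store} (hσ : ∀ j < n, σ j r ≠ [] ∧ Runs c (σ j) T (σ (j + 1)))
    (hn : σ n r = []) : Runs (.loop r c) (σ 0) (n * (T + 1) + 1) (σ n) := by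
  induction n generalizing σ with
  | zero => exact ⟨1, by omega, .loopDone hn⟩
  | succ n ih =>
    obtain ⟨h0, t, ht, e⟩ := hσ 0 (by omega)
    obtain ⟨t', ht', e'⟩ := ih (σ := fun j => σ (j + 1)) (fun j hj => hσ (j + 1) (by omega)) hn
    exact ⟨t + t' + 1, by ring_nf at ht' ⊢; omega, .loopStep h0 e e'⟩

/-! ### Clearing, moving and copying stacks -/

/-- Empty the stack `r`. -/
def clear (r : ℕ) : Program := .loop r (.pop r)

theorem clear_spec (r : ℕ) (s : Store) :
    Runs (clear r) s (2 * (s r).length + 1) (Function.update s r []) := by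
  have h := loop (c := .pop r) (r := r) (n := (s r).length) (T := 1)
    (σ := fun j => Function.update s r ((s r).drop j)) (fun j hj => ⟨by simpa using hj, by
      simpa using pop (s := Function.update s r ((s r).drop j)) r⟩) (by simp)
  simp only [List.drop_zero, Function.update_eq_self, List.drop_length] at h
  exact h.mono (by omega)

/-- Empty the `n` stacks from `a` on. -/
def clearRange (a : ℕ) : ℕ → Program
  | 0 => .nop
  | n + 1 => .seq (clearRange a n) (clear (a + n))

theorem clearRange_spec (a n : ℕ) (s : Store) (B : ℕ) (hB : ∀ r, a ≤ r → (s r).length ≤ B) :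
    Runs (clearRange a n) s (n * (2 * B + 1) + 1)
      fun r => if a ≤ r ∧ r < a + n then [] else s r := by
  induction n with
  | zero =>
    refine nop.congr (by omega) ?_
    funext r; rw [if_neg (by omega)]
  | succ n ih =>
    have h := ih.seq (clear_spec (a + n) _)
    simp only [show ¬ (a ≤ a + n ∧ a + n < a + n) by omega, if_false] at h
    refine h.congr (by have := hB (a + n) (by omega); rw [Nat.add_one_mul n]; omega) ?_
    funext r
    by_cases e : r = a + n
    · subst e; simp
    · rw [Function.update_of_ne e]
      congr 1
      exact propext ⟨fun h => by omega, fun h => by omega⟩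

/-- Move the bits of the stack `a` one by one onto the stacks `b` and `b'`. -/
def pour₂ (a b b' : ℕ) : Program :=
  .loop a (.branch a (.seq (.pop a) (.seq (.push b true) (.push b' true)))
    (.seq (.pop a) (.seq (.push b false) (.push b' false))) .nop)

/-- Move the bits of the stack `a` one by one onto the stack `b`. -/
def pour (a b : ℕ) : Program :=
  .loop a (.branch a (.seq (.pop a) (.push b true)) (.seq (.pop a) (.push b false)) .nop)

theorem branch {r : ℕ} {b : Bool} {l : List Bool} {c₁ c₀ ce : Program} (hr : s r = b :: l)
    (h : Runs (if b then c₁ else c₀) s T s') : Runs (.branch r c₁ c₀ ce) s (T + 1) s' := by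
  obtain ⟨t, ht, e⟩ := h
  cases b
  · exact ⟨t + 1, by omega, .branchZero (by simp [hr]) e⟩
  · exact ⟨t + 1, by omega, .branchOne (by simp [hr]) e⟩

theorem pour_spec {a b : ℕ} (hab : a ≠ b) (s : Store) :
    Runs (pour a b) s (4 * (s a).length + 1)
      (Function.update (Function.update s b ((s a).reverse ++ s b)) a []) := by
  -- Before round `j`, the first `j` bits of the stack `a` lie in reverse order on top of `b`.
  have h := loop (r := a) (n := (s a).length) (T := 3)
    (c := .branch a (.seq (.pop a) (.push b true)) (.seq (.pop a) (.push b false)) .nop)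
    (σ := fun j => Function.update (Function.update s b (((s a).take j).reverse ++ s b)) a
      ((s a).drop j)) (fun j hj => ⟨by simpa using hj, by
        have e : (s a).drop j = (s a)[j] :: (s a).drop (j + 1) := List.drop_eq_getElem_cons hj
        have e' : ((s a).take (j + 1)).reverse = (s a)[j] :: ((s a).take j).reverse := by
          rw [List.take_succ_eq_append_getElem hj, List.reverse_append]; rfl
        refine branch (b := (s a)[j]) (l := (s a).drop (j + 1))
          (by rw [Function.update_self, e]) ?_
        have := fun b' => seq (T := 1) (T' := 1) (pop (s := Function.update (Function.update s b
          (((s a).take j).reverse ++ s b)) a ((s a).drop j)) a) (push b b')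
        have h2 : Runs (.seq (.pop a) (.push b (s a)[j])) (Function.update (Function.update s b
          (((s a).take j).reverse ++ s b)) a ((s a).drop j)) 2 (Function.update (Function.update s b
          (((s a).take (j + 1)).reverse ++ s b)) a ((s a).drop (j + 1))) := by
          convert this (s a)[j] using 1
          funext r
          by_cases h1 : r = b
          · subst h1
            simp [Ne.symm hab, e']
          · by_cases h2 : r = a
            · subst h2; simp [h1]
            · simp [Function.update_apply, h1, h2]
        cases hb : (s a)[j] <;> rw [hb] at h2 <;> exact h2⟩) (by simp)
  simp only [List.drop_zero, List.take_zero, List.reverse_nil, List.nil_append,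
    Function.update_eq_self, List.drop_length, List.take_length] at h
  exact h.mono (by omega)

theorem pour₂_spec {a b b' : ℕ} (hab : a ≠ b) (hab' : a ≠ b') (hbb : b ≠ b') (s : Store) :
    Runs (pour₂ a b b') s (5 * (s a).length + 1)
      (Function.update (Function.update (Function.update s b ((s a).reverse ++ s b)) b'
        ((s a).reverse ++ s b')) a []) := by
  let σ : ℕ → Store := fun j => Function.update (Function.update (Function.update s b
    (((s a).take j).reverse ++ s b)) b' (((s a).take j).reverse ++ s b')) a ((s a).drop j)
  have h := loop (r := a) (n := (s a).length) (T := 4)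
    (c := .branch a (.seq (.pop a) (.seq (.push b true) (.push b' true)))
      (.seq (.pop a) (.seq (.push b false) (.push b' false))) .nop)
    (σ := σ) (fun j hj => ⟨by simpa [σ] using hj, by
        have e : (s a).drop j = (s a)[j] :: (s a).drop (j + 1) := List.drop_eq_getElem_cons hj
        have e' : ((s a).take (j + 1)).reverse = (s a)[j] :: ((s a).take j).reverse := by
          rw [List.take_succ_eq_append_getElem hj, List.reverse_append]; rfl
        refine branch (b := (s a)[j]) (l := (s a).drop (j + 1))
          (by simp only [σ]; rw [Function.update_self, e]) ?_
        have := fun q => seq (T := 1) (T' := 2) (pop (s := σ j) a)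
          (seq (T := 1) (T' := 1) (push b q) (push b' q))
        have h2 : Runs (.seq (.pop a) (.seq (.push b (s a)[j]) (.push b' (s a)[j]))) (σ j) 3
            (σ (j + 1)) := by
          convert this (s a)[j] using 1
          funext r
          by_cases h1 : r = b
          · subst h1
            simp [σ, Ne.symm hab, hbb, e']
          · by_cases h2 : r = b'
            · subst h2
              simp [σ, Ne.symm hab', Ne.symm hbb, e']
            · by_cases h3 : r = a
              · subst h3; simp [σ, h1, h2]
              · simp [σ, Function.update_apply, h1, h2, h3]
        cases hb : (s a)[j] <;> rw [hb] at h2 <;> exact h2⟩) (by simp [σ])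
  simp only [σ, List.drop_zero, List.take_zero, List.reverse_nil, List.nil_append,
    Function.update_eq_self, List.drop_length, List.take_length] at h
  exact h.mono (by omega)

/-- Move the contents of the stack `a` to the stack `b`, by way of the stack `t`. -/
def move (a b t : ℕ) : Program := .seq (pour a t) (pour t b)

/-- Pouring reverses a word, so pouring twice restores its order, and the auxiliary stack is empty
again. -/
theorem move_spec {a b t : ℕ} (hab : a ≠ b) (hat : a ≠ t) (hbt : b ≠ t) (s : Store)
    (ht : s t = []) (hb : s b = []) : Runs (move a b t) s (8 * (s a).length + 2)
      (Function.update (Function.update s b (s a)) a []) := by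
  have h := (pour_spec hat s).seq (pour_spec hbt.symm _)
  simp only [ht, List.append_nil, Function.update_self, ne_eq, hat.symm, not_false_eq_true,
    Function.update_of_ne, hab.symm, hbt, hb, List.reverse_reverse, List.length_reverse] at h
  refine h.congr (by omega) ?_
  funext r
  simp only [Function.update_apply]
  split_ifs <;> simp_all

/-- Copy the contents of the stack `a` to the stack `b`, by way of the stack `t`. -/
def copy (a b t : ℕ) : Program := .seq (pour a t) (pour₂ t a b)

theorem copy_spec {a b t : ℕ} (hab : a ≠ b) (hat : a ≠ t) (hbt : b ≠ t) (s : Store)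
    (ht : s t = []) (hb : s b = []) : Runs (copy a b t) s (9 * (s a).length + 2)
      (Function.update s b (s a)) := by
  have h := (pour_spec hat s).seq (pour₂_spec hat.symm hbt.symm hab _)
  simp only [ht, List.append_nil, Function.update_self, ne_eq, hat.symm, not_false_eq_true,
    Function.update_of_ne, hab.symm, hbt, hb, List.reverse_reverse, List.length_reverse] at h
  refine h.congr (by omega) ?_
  funext r
  simp only [Function.update_apply]
  split_ifs <;> simp_all

end Runs
/-! ### Stores given by lists of words -/

theorem initStore_append_left {l l' : List (List Bool)} {r : ℕ} (h : r < l.length) :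
    initStore (l ++ l') r = initStore l r := by
  simp only [initStore, List.getD_append _ _ _ _ h]

theorem initStore_append_right (l l' : List (List Bool)) (k : ℕ) :
    initStore (l ++ l') (l.length + k) = initStore l' k := by
  simp [initStore, List.getD_eq_getElem?_getD, List.getElem?_append_right]

theorem initStore_of_le {l : List (List Bool)} {r : ℕ} (h : l.length ≤ r) : initStore l r = [] := by
  simp only [initStore, List.getD_eq_default _ _ h]

/-- A trailing empty word is invisible in the store, so free workspace can be added to the list or
dropped from it at will. -/
theorem initStore_append_nil (l : List (List Bool)) : initStore (l ++ [[]]) = initStore l := by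
  funext r
  rcases lt_or_ge r l.length with h | h
  · rw [initStore_append_left h]
  · obtain ⟨k, rfl⟩ := Nat.exists_eq_add_of_le h
    rw [initStore_append_right, initStore_of_le h]
    rcases k with _ | k <;> rfl

/-- Turns updates of the store into list operations behind the context `l`; this is why the programs
below address stacks as `Γ.length + k`, even for `k = 0`. -/
theorem update_initStore {l l' : List (List Bool)} {k : ℕ} (hk : k < l'.length) (v : List Bool) :
    Function.update (initStore (l ++ l')) (l.length + k) v = initStore (l ++ l'.set k v) := by
  funext r
  by_cases e : r = l.length + k
  · subst e
    rw [Function.update_self, initStore_append_right]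
    simp [initStore, hk]
  · rw [Function.update_of_ne e]
    rcases lt_or_ge r l.length with h | h
    · rw [initStore_append_left h, initStore_append_left h]
    · obtain ⟨q, rfl⟩ := Nat.exists_eq_add_of_le h
      rw [initStore_append_right, initStore_append_right]
      have : k ≠ q := fun h => e (by rw [h])
      simp [initStore, List.getD_eq_getElem?_getD, List.getElem?_set_ne this]

/-! ### Families of words computable in polynomial time -/

/-- From the words `Γ` on the first stacks, a program computes the word `f` onto the next stack, in
time polynomial in the size `M`, and leaves all other stacks as they were. -/
def Comp {ι : Type} (M : ι → ℕ) (Γ : List (ι → List Bool)) (f : ι → List Bool) : Prop :=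
  ∃ (c : Program) (T : ι → ℕ), PolyBounded M T ∧ ∀ i,
    Runs c (initStore (Γ.map (· i))) (T i) (initStore (Γ.map (· i) ++ [f i]))

/-- The computable families of bits. -/
def CompB {ι : Type} (M : ι → ℕ) (Γ : List (ι → List Bool)) (b : ι → Bool) : Prop :=
  Comp M Γ fun i => [b i]

/-- The computable families of natural numbers, in unary. -/
def CompN {ι : Type} (M : ι → ℕ) (Γ : List (ι → List Bool)) (n : ι → ℕ) : Prop :=
  Comp M Γ fun i => unary (n i)

/-- Everything computable from `Γ` is, along `π`, computable from `Γ'`. -/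
def Lift {ι ι' : Type} (M : ι → ℕ) (Γ : List (ι → List Bool)) (π : ι' → ι)
    (Γ' : List (ι' → List Bool)) : Prop :=
  ∀ f, Comp M Γ f → Comp (fun p => M (π p)) Γ' fun p => f (π p)

namespace Comp

variable {ι : Type} {M : ι → ℕ} {Γ : List (ι → List Bool)} {f g : ι → List Bool}

theorem congr (h : Comp M Γ f) (e : ∀ i, f i = g i) : Comp M Γ g := by
  obtain rfl : f = g := funext e
  exact h

theorem polyBounded (h : Comp M Γ f) : PolyBounded M fun i => (f i).length := by
  obtain ⟨c, T, hT, h⟩ := h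
  refine hT.mono fun i => ?_
  obtain ⟨t, ht, e⟩ := h i
  have := e.length_le ((Γ.map (· i)).length + 0)
  have h0 : initStore (Γ.map (· i)) ((Γ.map (· i)).length + 0) = [] := initStore_of_le (by simp)
  rw [initStore_append_right, h0] at this
  simpa using (show (f i).length ≤ 0 + t from this).trans (by omega)

/-- The words of `Δ` are inserted between the inputs and the workspace: the stacks from `Γ.length`
on move up by `Δ.length`, and the stacks skipped by this renaming stay untouched. -/
theorem weaken (h : Comp M Γ f) (Δ : List (ι → List Bool)) : Comp M (Γ ++ Δ) f := by
  obtain ⟨c, T, hT, h⟩ := h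
  refine ⟨c.rename fun r => if r < Γ.length then r else r + Δ.length, T, hT, fun i => ?_⟩
  obtain ⟨t, ht, e⟩ := h i
  have hl : (Γ.map (· i)).length = Γ.length := List.length_map _
  have hl' : (Δ.map (· i)).length = Δ.length := List.length_map _
  obtain ⟨S', e', h1, h2⟩ := e.rename (φ := fun r => if r < Γ.length then r else r + Δ.length)
    (fun a b hab => by simp only at hab; split_ifs at hab <;> omega)
    (initStore ((Γ ++ Δ).map (· i))) (fun r => by
      rw [List.map_append]
      split_ifs with hr
      · rw [initStore_append_left (by omega)]
      · rw [initStore_of_le (by simp; omega), initStore_of_le (by omega)])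
  refine ⟨t, ht, ?_⟩
  convert e'
  funext x
  rw [List.map_append]
  by_cases hx : x < Γ.length
  · have := h1 x
    rw [if_pos hx, initStore_append_left (by omega)] at this
    rw [this, List.append_assoc, initStore_append_left (by omega)]
  · by_cases hx' : x < Γ.length + Δ.length
    · rw [h2 x, List.map_append, initStore_append_left (by simp; omega)]
      rintro ⟨r, hr⟩
      simp only at hr
      split_ifs at hr <;> omega
    · obtain ⟨k, rfl⟩ := Nat.exists_eq_add_of_le (not_lt.1 hx')
      have := h1 (Γ.length + k)
      rw [if_neg (by omega), show Γ.length + k + Δ.length = Γ.length + Δ.length + k by omega] at this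
      rw [this, ← hl, initStore_append_right, ← hl', ← List.length_append, initStore_append_right]

theorem pullback (h : Comp M Γ f) {ι' : Type} (π : ι' → ι) :
    Comp (fun p => M (π p)) (Γ.map fun f p => f (π p)) fun p => f (π p) := by
  obtain ⟨c, T, hT, h⟩ := h
  refine ⟨c, fun p => T (π p), hT.comp π, fun p => ?_⟩
  simpa [List.map_map, Function.comp_def] using h (π p)

theorem nil : Comp M Γ fun _ => [] :=
  ⟨.nop, _, .const 1, fun i => by rw [initStore_append_nil]; exact Runs.nop⟩

theorem cons (b : Bool) (h : Comp M Γ f) : Comp M Γ fun i => b :: f i := by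
  obtain ⟨c, T, hT, h⟩ := h
  refine ⟨.seq c (.push (Γ.length + 0) b), _, hT.add (.const 1), fun i => (h i).seq ?_⟩
  have hl : (Γ.map (· i)).length = Γ.length := List.length_map _
  refine (Runs.push _ b).congr le_rfl ?_
  rw [← hl, initStore_append_right, update_initStore (by simp)]
  rfl

theorem tail (h : Comp M Γ f) : Comp M Γ fun i => (f i).tail := by
  obtain ⟨c, T, hT, h⟩ := h
  refine ⟨.seq c (.pop (Γ.length + 0)), _, hT.add (.const 1), fun i => (h i).seq ?_⟩
  have hl : (Γ.map (· i)).length = Γ.length := List.length_map _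
  refine (Runs.pop _).congr le_rfl ?_
  rw [← hl, initStore_append_right, update_initStore (by simp)]
  rfl

theorem var (hf : f ∈ Γ) (hb : PolyBounded M fun i => (f i).length) : Comp M Γ f := by
  obtain ⟨j, hj, rfl⟩ := List.getElem_of_mem hf
  refine ⟨Runs.copy j (Γ.length + 0) (Γ.length + 1), _,
    ((PolyBounded.const 9).mul hb).add (.const 2), fun i => ?_⟩
  have hl : (Γ.map (· i)).length = Γ.length := List.length_map _
  have hv : initStore (Γ.map (· i)) j = Γ[j] i := by
    simp [initStore, hj]
  refine (Runs.copy_spec (by omega) (by omega) (by omega) _ (initStore_of_le (by omega))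
    (initStore_of_le (by omega))).congr (by rw [hv]) ?_
  rw [hv, ← initStore_append_nil, ← hl, update_initStore (by simp)]
  rfl

theorem ite {b : ι → Bool} (hb : CompB M Γ b) (hf : Comp M Γ f) (hg : Comp M Γ g) :
    Comp M Γ fun i => if b i then f i else g i := by
  obtain ⟨c, T, hT, h⟩ := hb
  obtain ⟨c₁, T₁, hT₁, h₁⟩ := hf
  obtain ⟨c₀, T₀, hT₀, h₀⟩ := hg
  refine ⟨.seq c (.branch (Γ.length + 0) (.seq (.pop (Γ.length + 0)) c₁)
    (.seq (.pop (Γ.length + 0)) c₀) .nop), _, hT.add (((PolyBounded.const 1).add (hT₁.add hT₀)).add (.const 1)),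
    fun i => (h i).seq ?_⟩
  have hl : (Γ.map (· i)).length = Γ.length := List.length_map _
  refine Runs.branch (T := 1 + (T₁ i + T₀ i)) (b := b i) (l := []) (by rw [← hl, initStore_append_right]; rfl) ?_
  -- Removing the tested bit restores the original store, in which the programs of both branches are
  -- known to work.
  have hp : Runs (.pop (Γ.length + 0)) (initStore (Γ.map (· i) ++ [[b i]])) 1
      (initStore (Γ.map (· i))) := by
    refine (Runs.pop _).congr le_rfl ?_
    rw [← hl, initStore_append_right, update_initStore (by simp),
      ← initStore_append_nil (Γ.map (· i))]
    rfl
  cases hb : b i <;> rw [hb] at hp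
  · simp only [hb, Bool.false_eq_true, if_false]
    exact (hp.seq (h₀ i)).mono (by omega)
  · simp only [hb, if_true]
    exact (hp.seq (h₁ i)).mono (by omega)

/-- The instances of the steps of a loop: an instance and the number of a step. -/
abbrev Step (n : ι → ℕ) : Type := {p : ι × ℕ // p.2 < n p.1}

/-- Iteration: if one step is computable and the intermediate results are bounded, then the
last result is computable. -/
theorem iter_length {l : ι → List Bool} {n : ι → ℕ} {acc : ι → ℕ → List Bool} (hn : Comp M Γ l)
    (hln : ∀ i, (l i).length = n i)
    (h0 : Comp M Γ fun i => acc i 0)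
    (hb : PolyBounded (fun p : Step n => M p.1.1) fun p => (acc p.1.1 p.1.2).length)
    (hs : ∀ Γ' : List (Step n → List Bool), Lift M Γ (fun p => p.1.1) Γ' →
      CompN (fun p => M p.1.1) Γ' (fun p => p.1.2) →
      Comp (fun p => M p.1.1) Γ' (fun p => acc p.1.1 p.1.2) →
      Comp (fun p => M p.1.1) Γ' fun p => acc p.1.1 (p.1.2 + 1)) :
    Comp M Γ fun i => acc i (n i) := by
  have hbn := hn.polyBounded
  simp only [hln] at hbn
  have hbn' : PolyBounded (fun p : Step n => M p.1.1) fun p => (unary p.1.2).length := by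
    refine (hbn.comp fun p : Step n => p.1.1).mono fun p => ?_
    simpa [unary] using p.2.le
  -- A round sees three words behind the context: the rest of `l`, which the loop tests and
  -- consumes, the number of the round, which the loop body may need, and the current result.
  have hstep := hs (Γ.map (fun f p => f p.1.1) ++ [fun p => (l p.1.1).drop p.1.2,
      fun p => unary p.1.2, fun p => acc p.1.1 p.1.2]) (fun f hf => (hf.pullback _).weaken _)
    (var (by simp) hbn') (var (by simp) hb)
  have hb1 := hstep.polyBounded
  obtain ⟨c₁, T₁, hT₁, h₁⟩ := hn
  obtain ⟨c₂, T₂, hT₂, h₂⟩ := h0.weaken [l, fun _ => []]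
  obtain ⟨c, T, ⟨K, hK⟩, h⟩ := hstep
  obtain ⟨K', hK'⟩ := hb
  obtain ⟨K'', hK''⟩ := hb1
  -- The hypothesis `hb` covers only the results before a round. The final one is either the initial
  -- result or the outcome of round `n i - 1`.
  have hfin : PolyBounded M fun i => (acc i (n i)).length := by
    refine (h0.polyBounded.add (⟨K'', fun i => le_rfl⟩ : PolyBounded M _)).mono fun i => ?_
    rcases hni : n i with _ | k
    · simp
    · have := hK'' ⟨(i, k), by simp [hni]⟩
      simp only at this ⊢
      omega
  -- In each round `c` writes the new result on the fourth stack; then the counter is popped, the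
  -- round number incremented, and the old result replaced by the new one.
  refine ⟨.seq c₁ (.seq c₂ (.seq (.loop (Γ.length + 0) (.seq c (.seq (.pop (Γ.length + 0))
    (.seq (.push (Γ.length + 1) true) (.seq (Runs.clear (Γ.length + 2))
    (Runs.move (Γ.length + 3) (Γ.length + 2) (Γ.length + 4)))))))
    (.seq (Runs.clear (Γ.length + 1)) (Runs.move (Γ.length + 2) (Γ.length + 0) (Γ.length + 1))))),
    fun i => T₁ i + (T₂ i + (n i * ((M i + 2) ^ K + (1 + (1 + ((2 * (M i + 2) ^ K' + 1)
      + (8 * (M i + 2) ^ K'' + 2)))) + 1) + 1 + ((2 * n i + 1) + (8 * (acc i (n i)).length + 2)))),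
    ?_, fun i => ?_⟩
  · have q : ∀ K, PolyBounded M fun i => (M i + 2) ^ K := fun K => ⟨K, fun i => le_rfl⟩
    have k : ∀ a, PolyBounded M fun _ => a := .const
    exact hT₁.add (hT₂.add (((hbn.mul (((q K).add ((k 1).add ((k 1).add ((((k 2).mul (q K')).add
      (k 1)).add (((k 8).mul (q K'')).add (k 2)))))).add (k 1))).add (k 1)).add
      ((((k 2).mul hbn).add (k 1)).add (((k 8).mul hfin).add (k 2)))))
  · have hl : (Γ.map (· i)).length = Γ.length := List.length_map _
    refine (h₁ i).seq (Runs.seq (s' := initStore (Γ.map (· i) ++ [l i, [], acc i 0])) ?_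
      (Runs.seq (s' := initStore (Γ.map (· i) ++ [[], unary (n i), acc i (n i)])) ?_ ?_))
    · have := h₂ i
      simp only [List.map_append, List.map_cons, List.map_nil, List.append_assoc, List.cons_append,
        List.nil_append] at this
      rw [show Γ.map (· i) ++ [l i, []] = Γ.map (· i) ++ [l i] ++ [[]] by simp,
        initStore_append_nil] at this
      exact this
    · have key := Runs.loop (r := Γ.length + 0) (n := n i)
        (T := (M i + 2) ^ K + (1 + (1 + ((2 * (M i + 2) ^ K' + 1) + (8 * (M i + 2) ^ K'' + 2)))))
        (c := .seq c (.seq (.pop (Γ.length + 0))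
          (.seq (.push (Γ.length + 1) true) (.seq (Runs.clear (Γ.length + 2))
          (Runs.move (Γ.length + 3) (Γ.length + 2) (Γ.length + 4))))))
        (σ := fun j => initStore (Γ.map (· i) ++ [(l i).drop j, unary j, acc i j]))
        (fun j hj => ⟨?_, ?_⟩) ?_
      · have hd : (l i).drop (n i) = [] := by rw [← hln, List.drop_length]
        simpa [hd, unary] using key
      · rw [← hl, initStore_append_right]
        simp [initStore, hln, hj]
      · have hc := (h ⟨(i, j), hj⟩).mono (hK _)
        have ha := hK' ⟨(i, j), hj⟩
        have ha' := hK'' ⟨(i, j), hj⟩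
        simp only [List.map_append, List.map_map, Function.comp_def, List.map_cons, List.map_nil,
          List.append_assoc, List.cons_append, List.nil_append] at hc ha ha'
        refine hc.seq (Runs.seq (s' := initStore (Γ.map (· i) ++ [(l i).drop (j + 1), unary j,
          acc i j, acc i (j + 1)])) ?_ (Runs.seq (s' := initStore (Γ.map (· i) ++
          [(l i).drop (j + 1), unary (j + 1), acc i j, acc i (j + 1)])) ?_
          (Runs.seq (s' := initStore (Γ.map (· i) ++ [(l i).drop (j + 1), unary (j + 1),
          [], acc i (j + 1)])) ?_ ?_)))
        · refine (Runs.pop _).congr le_rfl ?_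
          rw [← hl, update_initStore (by simp), initStore_append_right]
          simp [initStore]
        · refine (Runs.push _ _).congr le_rfl ?_
          rw [← hl, update_initStore (by simp), initStore_append_right]
          rfl
        · refine (Runs.clear_spec _ _).congr ?_ ?_
          · rw [← hl, initStore_append_right]
            simp only [initStore, List.getD_cons_succ, List.getD_cons_zero]
            omega
          · rw [← hl, update_initStore (by simp)]
            rfl
        · refine (Runs.move_spec (by omega) (by omega) (by omega) _
            (initStore_of_le (by simp)) ?_).congr ?_ ?_
          · rw [← hl, initStore_append_right]; rfl
          · rw [← hl, initStore_append_right]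
            simp only [initStore, List.getD_cons_succ, List.getD_cons_zero]
            omega
          · rw [← hl, initStore_append_right, update_initStore (by simp),
              update_initStore (by simp), ← initStore_append_nil (_ ++ [(l i).drop (j + 1), _, _])]
            simp [initStore]
      · rw [← hl, initStore_append_right]
        simp [initStore, hln]
    · refine Runs.seq (s' := initStore (Γ.map (· i) ++ [[], [], acc i (n i)])) ?_ ?_
      · refine (Runs.clear_spec _ _).congr ?_ ?_
        · rw [← hl, initStore_append_right]
          simp [initStore, unary]
        · rw [← hl, update_initStore (by simp)]
          rfl
      · refine (Runs.move_spec (by omega) (by omega) (by omega) _ ?_ ?_).congr ?_ ?_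
        · rw [← hl, initStore_append_right]; rfl
        · rw [← hl, initStore_append_right]; rfl
        · rw [← hl, initStore_append_right]
          simp [initStore]
        · rw [← hl, initStore_append_right, update_initStore (by simp), update_initStore (by simp),
            ← initStore_append_nil (_ ++ [acc i (n i)]), ← initStore_append_nil (_ ++ [acc i (n i)] ++ _)]
          simp [initStore]

theorem iter {n : ι → ℕ} {acc : ι → ℕ → List Bool} (hn : CompN M Γ n)
    (h0 : Comp M Γ fun i => acc i 0)
    (hb : PolyBounded (fun p : Step n => M p.1.1) fun p => (acc p.1.1 p.1.2).length)
    (hs : ∀ Γ' : List (Step n → List Bool), Lift M Γ (fun p => p.1.1) Γ' →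
      CompN (fun p => M p.1.1) Γ' (fun p => p.1.2) →
      Comp (fun p => M p.1.1) Γ' (fun p => acc p.1.1 p.1.2) →
      Comp (fun p => M p.1.1) Γ' fun p => acc p.1.1 (p.1.2 + 1)) :
    Comp M Γ fun i => acc i (n i) :=
  iter_length hn (fun _ => List.length_replicate) h0 hb hs

/-- A context for the steps of a loop. -/
theorem exists_lift {n : ι → ℕ} (hn : CompN M Γ n) : ∃ Γ' : List (Step n → List Bool),
    Lift M Γ (fun p => p.1.1) Γ' ∧ CompN (fun p => M p.1.1) Γ' fun p => p.1.2 := by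
  refine ⟨Γ.map (fun f p => f p.1.1) ++ [fun p => unary p.1.2],
    fun f hf => (hf.pullback _).weaken _, var (by simp) ?_⟩
  refine (hn.polyBounded.comp fun p : Step n => p.1.1).mono fun p => ?_
  simpa [unary] using p.2.le

theorem reverse (h : Comp M Γ f) : Comp M Γ fun i => (f i).reverse := by
  have hb := h.polyBounded
  obtain ⟨c, T, hT, h⟩ := h
  have k : ∀ a, PolyBounded M fun _ => a := .const
  refine ⟨.seq c (.seq (Runs.pour (Γ.length + 0) (Γ.length + 1))
    (Runs.move (Γ.length + 1) (Γ.length + 0) (Γ.length + 2))), _,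
    hT.add ((((k 4).mul hb).add (k 1)).add (((k 8).mul hb).add (k 2))), fun i => (h i).seq ?_⟩
  have hl : (Γ.map (· i)).length = Γ.length := List.length_map _
  refine Runs.seq (s' := initStore (Γ.map (· i) ++ [[], (f i).reverse])) ?_ ?_
  · refine (Runs.pour_spec (by omega) _).congr ?_ ?_
    · rw [← hl, initStore_append_right]; rfl
    · rw [← initStore_append_nil, List.append_assoc, ← hl, initStore_append_right,
        initStore_append_right, update_initStore (by simp), update_initStore (by simp)]
      simp [initStore]
  · refine (Runs.move_spec (by omega) (by omega) (by omega) _ (initStore_of_le (by simp))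
      ?_).congr ?_ ?_
    · rw [← hl, initStore_append_right]; rfl
    · rw [← hl, initStore_append_right]; simp [initStore]
    · rw [← hl, initStore_append_right, update_initStore (by simp), update_initStore (by simp),
        ← initStore_append_nil (_ ++ [(f i).reverse])]
      simp [initStore]

theorem head (h : Comp M Γ f) : CompB M Γ fun i => (f i).headD false := by
  have hb := h.polyBounded
  obtain ⟨c, T, hT, h⟩ := h
  have k : ∀ a, PolyBounded M fun _ => a := .const
  refine ⟨.seq c (.branch (Γ.length + 0)
    (.seq (Runs.clear (Γ.length + 0)) (.push (Γ.length + 0) true))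
    (.seq (Runs.clear (Γ.length + 0)) (.push (Γ.length + 0) false)) (.push (Γ.length + 0) false)), _,
    hT.add (((((k 2).mul hb).add (k 1)).add (k 1)).add (k 1)), fun i => (h i).seq ?_⟩
  have hl : (Γ.map (· i)).length = Γ.length := List.length_map _
  have hc : ∀ b, Runs (.seq (Runs.clear (Γ.length + 0)) (.push (Γ.length + 0) b))
      (initStore (Γ.map (· i) ++ [f i])) (2 * (f i).length + 1 + 1)
      (initStore (Γ.map (· i) ++ [[b]])) := fun b => by
    refine Runs.seq (s' := initStore (Γ.map (· i) ++ [[]])) ((Runs.clear_spec _ _).congr ?_ ?_)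
      ((Runs.push _ b).congr le_rfl ?_)
    · rw [← hl, initStore_append_right]; rfl
    · rw [← hl, update_initStore (by simp)]; rfl
    · rw [← hl, update_initStore (by simp), initStore_append_right]; rfl
  have hv : initStore (Γ.map (· i) ++ [f i]) (Γ.length + 0) = f i := by
    rw [← hl, initStore_append_right]; rfl
  rcases hf : f i with _ | ⟨b, l⟩
  · have hp := Runs.push (s := initStore (Γ.map (· i) ++ [f i])) (Γ.length + 0) false
    obtain ⟨t, ht, e⟩ := hp
    rw [hf] at e hv
    refine ⟨t + 1, by omega, .branchEmpty hv ?_⟩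
    convert e using 1
    rw [hv, ← hl, update_initStore (by simp)]
    simp only [hf]
    rfl
  · rw [hf] at hc hv
    refine Runs.branch hv ?_
    simp only [hf]
    cases b
    · exact hc false
    · exact hc true

/-- Calling a program as a subroutine. -/
theorem call {G : Program} {f₁ f₂ : ι → List Bool} {T : ι → ℕ} (h₁ : Comp M Γ f₁)
    (h₂ : Comp M Γ f₂) (hT : PolyBounded M T)
    (hG : ∀ i, G.ComputesInTime [f₁ i, f₂ i] (f i) (T i)) : Comp M Γ f := by
  have hb₁ := h₁.polyBounded
  have hb₂ := h₂.polyBounded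
  obtain ⟨c₁, T₁, hT₁, h₁⟩ := h₁
  obtain ⟨c₂, T₂, hT₂, h₂⟩ := h₂.weaken [f₁]
  have hl : ∀ i, (Γ.map (· i)).length = Γ.length := fun i => List.length_map _
  -- `G` runs entirely behind the context. The cleaning spares its output stack; the summand 2 makes
  -- the range contain the second input stack even if `G` never changes it.
  refine ⟨.seq c₁ (.seq c₂ (.seq (G.rename fun r => Γ.length + r)
    (Runs.clearRange (Γ.length + 1) (G.bound + 2)))), fun i => T₁ i + (T₂ i + (T i +
      ((G.bound + 2) * (2 * ((f₁ i).length + (f₂ i).length + T i) + 1) + 1))), ?_, fun i => ?_⟩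
  · exact hT₁.add (hT₂.add (hT.add (((PolyBounded.const _).mul (((PolyBounded.const 2).mul
      ((hb₁.add hb₂).add hT)).add (.const 1))).add (.const 1))))
  · have e₂ := h₂ i
    simp only [List.map_append, List.map_cons, List.map_nil, List.append_assoc, List.cons_append,
      List.nil_append] at e₂
    obtain ⟨t, s, ht, e, hs⟩ := hG i
    obtain ⟨S, e', h1, h2⟩ := e.rename (φ := fun r => Γ.length + r) (fun a b h => by simpa using h)
      (initStore (Γ.map (· i) ++ [f₁ i, f₂ i])) (fun r => by rw [← hl i, initStore_append_right])
    refine (h₁ i).seq (e₂.seq (Runs.seq (s' := S) ⟨t, ht, e'⟩ ?_))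
    refine (Runs.clearRange_spec _ _ S ((f₁ i).length + (f₂ i).length + T i) fun r hr => ?_).congr
      le_rfl ?_
    · obtain ⟨k, rfl⟩ := Nat.exists_eq_add_of_le (show Γ.length ≤ r by omega)
      rw [h1]
      refine (e.length_le k).trans ?_
      have : (initStore [f₁ i, f₂ i] k).length ≤ (f₁ i).length + (f₂ i).length := by
        rcases k with _ | _ | k <;> simp [initStore]
      omega
    · funext r
      rcases lt_or_ge r Γ.length with hr | hr
      · rw [if_neg (by omega), initStore_append_left (by rw [hl]; exact hr), h2,
          initStore_append_left (by rw [hl]; exact hr)]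
        rintro ⟨k, hk⟩
        simp only at hk
        omega
      · obtain ⟨k, rfl⟩ := Nat.exists_eq_add_of_le hr
        rw [h1, ← hl i, initStore_append_right, hl i]
        rcases k with _ | k
        · rw [if_neg (by omega), hs]; rfl
        · split_ifs with hk
          · rw [initStore_of_le (by simp)]
          · rw [e.eq_of_bound_le (by omega), initStore_of_le (by simp; omega),
              initStore_of_le (by simp)]

/-- A program that computes a word from inputs on the first stacks. -/
theorem exists_program (h : Comp M (g :: Γ) f) (hg : PolyBounded M fun i => (g i).length) :
    ∃ (c : Program) (T : ι → ℕ), PolyBounded M T ∧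
      ∀ i, c.ComputesInTime ((g :: Γ).map (· i)) (f i) (T i) := by
  have hb := h.polyBounded
  obtain ⟨c, T, hT, h⟩ := h
  have k : ∀ a, PolyBounded M fun _ => a := .const
  -- `ComputesInTime` reads stack 0 only, so the remaining inputs may stay where they are.
  refine ⟨.seq c (.seq (Runs.clear 0) (Runs.move (Γ.length + 1) 0 (Γ.length + 2))), _,
    hT.add ((((k 2).mul hg).add (k 1)).add (((k 8).mul hb).add (k 2))), fun i => ?_⟩
  have hf : initStore ((g :: Γ).map (· i) ++ [f i]) (Γ.length + 1) = f i := by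
    have := initStore_append_right ((g :: Γ).map (· i)) [f i] 0
    rw [List.length_map] at this
    exact this
  have hv := (h i).seq ((Runs.clear_spec 0 _).seq
    (Runs.move_spec (a := Γ.length + 1) (b := 0) (t := Γ.length + 2) (by omega) (by omega)
      (by omega) _ (by rw [Function.update_of_ne (by omega), initStore_of_le (by simp)]) (by simp)))
  rw [Function.update_of_ne (by omega), hf] at hv
  obtain ⟨t, ht, e⟩ := hv
  exact ⟨t, _, ht, e, by rw [Function.update_of_ne (by omega), Function.update_self]⟩

end Comp
/-! ### Closure properties of the computable families -/

section Closure

variable {ι : Type} {M : ι → ℕ} {Γ : List (ι → List Bool)} {f g : ι → List Bool} {a b n : ι → ℕ}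
  {p q : ι → Bool}

theorem Lift.nat {ι' : Type} {π : ι' → ι} {Γ' : List (ι' → List Bool)} (L : Lift M Γ π Γ')
    (h : CompN M Γ a) : CompN (fun p => M (π p)) Γ' fun p => a (π p) := L _ h

namespace CompN

theorem congr (h : CompN M Γ a) (e : ∀ i, a i = b i) : CompN M Γ b :=
  Comp.congr h fun i => by rw [e]

theorem polyBounded (h : CompN M Γ a) : PolyBounded M a :=
  (Comp.polyBounded h).mono fun i => by simp [unary]

theorem const (k : ℕ) : CompN M Γ fun _ => k := by
  induction k with
  | zero => exact Comp.nil
  | succ k ih => exact Comp.cons true ih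

theorem succ (h : CompN M Γ a) : CompN M Γ fun i => a i + 1 := Comp.cons true h

theorem length (h : Comp M Γ f) : CompN M Γ fun i => (f i).length := by
  refine Comp.iter_length (acc := fun _ j => unary j) h (fun _ => rfl) Comp.nil ?_ ?_
  · refine (h.polyBounded.comp fun p : Comp.Step fun i => (f i).length => p.1.1).mono fun p => ?_
    simpa [unary] using p.2.le
  · exact fun Γ' _ _ h => CompN.succ h

theorem add (ha : CompN M Γ a) (hb : CompN M Γ b) : CompN M Γ fun i => a i + b i := by
  refine Comp.iter (acc := fun i j => unary (a i + j)) hb ha ?_ ?_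
  · refine ((ha.polyBounded.add hb.polyBounded).comp fun p : Comp.Step b => p.1.1).mono fun p => ?_
    simpa [unary] using p.2.le
  · exact fun Γ' _ _ h => CompN.succ h

theorem sub (ha : CompN M Γ a) (hb : CompN M Γ b) : CompN M Γ fun i => a i - b i := by
  refine Comp.iter (acc := fun i j => unary (a i - j)) hb ha ?_ ?_
  · refine (ha.polyBounded.comp fun p : Comp.Step b => p.1.1).mono fun p => ?_
    simp [unary]
  · exact fun Γ' _ _ h => h.tail.congr fun p => by simp [unary, Nat.sub_sub]

theorem mul (ha : CompN M Γ a) (hb : CompN M Γ b) : CompN M Γ fun i => a i * b i := by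
  refine Comp.iter (acc := fun i j => unary (a i * j)) hb Comp.nil ?_ ?_
  · refine ((ha.polyBounded.mul hb.polyBounded).comp fun p : Comp.Step b => p.1.1).mono fun p => ?_
    simpa [unary] using Nat.mul_le_mul_left _ p.2.le
  · exact fun Γ' L _ h => CompN.add (a := fun p : Comp.Step b => a p.1.1 * p.1.2) h (L.nat ha)

theorem ite (hp : CompB M Γ p) (ha : CompN M Γ a) (hb : CompN M Γ b) :
    CompN M Γ fun i => if p i then a i else b i :=
  (Comp.ite hp ha hb).congr fun i => by simp only; split_ifs <;> rfl

end CompN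

theorem CompB.congr (h : CompB M Γ p) (e : ∀ i, p i = q i) : CompB M Γ q :=
  Comp.congr h fun i => by rw [e]

namespace CompB

theorem const (c : Bool) : CompB M Γ fun _ => c := Comp.nil.cons c

theorem ite {r : ι → Bool} (hp : CompB M Γ p) (hq : CompB M Γ q) (hr : CompB M Γ r) :
    CompB M Γ fun i => if p i then q i else r i :=
  (Comp.ite hp hq hr).congr fun i => by simp only; split_ifs <;> rfl

theorem not (hp : CompB M Γ p) : CompB M Γ fun i => !p i :=
  (hp.ite (const false) (const true)).congr fun i => by cases p i <;> rfl

theorem and (hp : CompB M Γ p) (hq : CompB M Γ q) : CompB M Γ fun i => p i && q i :=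
  (hp.ite hq (const false)).congr fun i => by cases p i <;> rfl

theorem or (hp : CompB M Γ p) (hq : CompB M Γ q) : CompB M Γ fun i => p i || q i :=
  (hp.ite (const true) hq).congr fun i => by cases p i <;> rfl

theorem xor (hp : CompB M Γ p) (hq : CompB M Γ q) : CompB M Γ fun i => p i ^^ q i :=
  (hp.ite hq.not hq).congr fun i => by cases p i <;> cases q i <;> rfl

/-- In unary, the truncated difference `b i - a i` has a top bit exactly if `a i < b i`; the default
`false` of `headD` is the answer otherwise. -/
theorem lt (ha : CompN M Γ a) (hb : CompN M Γ b) : CompB M Γ fun i => decide (a i < b i) := by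
  refine (Comp.head (hb.sub ha)).congr fun i => ?_
  simp only [unary]
  rcases h : b i - a i with _ | k
  · exact (decide_eq_false (by omega)).symm
  · exact (decide_eq_true (by omega)).symm

theorem le (ha : CompN M Γ a) (hb : CompN M Γ b) : CompB M Γ fun i => decide (a i ≤ b i) :=
  (lt hb ha).not.congr fun i => by simp [← decide_not]

theorem eq (ha : CompN M Γ a) (hb : CompN M Γ b) : CompB M Γ fun i => decide (a i = b i) :=
  ((le ha hb).and (le hb ha)).congr fun i => by simp [← Bool.decide_and, le_antisymm_iff]

end CompB

theorem Comp.drop (hf : Comp M Γ f) (hn : CompN M Γ n) : Comp M Γ fun i => (f i).drop (n i) := by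
  refine Comp.iter (acc := fun i j => (f i).drop j) hn hf ?_ ?_
  · refine (hf.polyBounded.comp fun p : Comp.Step n => p.1.1).mono fun p => ?_
    simp
  · exact fun Γ' _ _ h => h.tail.congr fun p => by simp

theorem CompB.getD (hf : Comp M Γ f) (hn : CompN M Γ n) :
    CompB M Γ fun i => (f i).getD (n i) false :=
  (Comp.head (hf.drop hn)).congr fun i => by
    rcases lt_or_ge (n i) (f i).length with h | h
    · rw [List.drop_eq_getElem_cons h]
      simp [h]
    · rw [List.drop_eq_nil_of_le h]
      simp [h]

/-- The computable families of bits indexed by the steps of a loop as well. -/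
def StepB {ι : Type} (M : ι → ℕ) (Γ : List (ι → List Bool)) (n : ι → ℕ) (f : ι → ℕ → Bool) :
    Prop :=
  ∀ Γ' : List (Comp.Step n → List Bool), Lift M Γ (fun p => p.1.1) Γ' →
    CompN (fun p => M p.1.1) Γ' (fun p => p.1.2) →
    CompB (fun p => M p.1.1) Γ' fun p => f p.1.1 p.1.2

/-- The computable families of numbers indexed by the steps of a loop as well. -/
def StepN {ι : Type} (M : ι → ℕ) (Γ : List (ι → List Bool)) (n : ι → ℕ) (f : ι → ℕ → ℕ) : Prop :=
  ∀ Γ' : List (Comp.Step n → List Bool), Lift M Γ (fun p => p.1.1) Γ' →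
    CompN (fun p => M p.1.1) Γ' (fun p => p.1.2) →
    CompN (fun p => M p.1.1) Γ' fun p => f p.1.1 p.1.2

/-- Bits are pushed onto the head of a word, so the loop produces the list in reverse order. -/
theorem Comp.filterMap {p f : ι → ℕ → Bool} (hn : CompN M Γ n)
    (hp : StepB M Γ n p) (hf : StepB M Γ n f) :
    Comp M Γ fun i => ((List.range (n i)).filter (p i)).map (f i) := by
  have h : Comp M Γ fun i => (((List.range (n i)).filter (p i)).map (f i)).reverse := by
    refine Comp.iter (acc := fun i j => (((List.range j).filter (p i)).map (f i)).reverse)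
      hn Comp.nil ?_ ?_
    · refine (hn.polyBounded.comp fun p : Comp.Step n => p.1.1).mono fun s => ?_
      simp only [List.length_reverse, List.length_map]
      exact (List.length_filter_le _ _).trans (by simpa using s.2.le)
    · intro Γ' L hj h
      have hc : Comp (fun p => M p.1.1) Γ' fun s : Comp.Step n =>
          f s.1.1 s.1.2 :: (((List.range s.1.2).filter (p s.1.1)).map (f s.1.1)).reverse :=
        (Comp.ite (hf Γ' L hj) (h.cons true) (h.cons false)).congr fun s => by
          split_ifs with h <;> simp [h]
      refine (Comp.ite (hp Γ' L hj) hc h).congr fun s => ?_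
      split_ifs with h <;> simp [List.range_succ, h]
  exact h.reverse.congr fun i => by simp

theorem Comp.tabulate {f : ι → ℕ → Bool} (hn : CompN M Γ n)
    (hf : StepB M Γ n f) : Comp M Γ fun i => (List.range (n i)).map (f i) :=
  (Comp.filterMap (p := fun _ _ => true) hn (fun _ _ _ => CompB.const true) hf).congr
    fun i => by simp

theorem CompN.sum {f : ι → ℕ → ℕ} (hn : CompN M Γ n) (hf : StepN M Γ n f) :
    CompN M Γ fun i => ∑ j ∈ Finset.range (n i), f i j := by
  refine Comp.iter (acc := fun i j => unary (∑ k ∈ Finset.range j, f i k)) hn Comp.nil ?_ ?_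
  -- The summands are computable, hence polynomially bounded uniformly in `j`; this bounds the
  -- partial sums.
  · obtain ⟨Γ', L, hj⟩ := Comp.exists_lift hn
    obtain ⟨K, hK⟩ := CompN.polyBounded (hf Γ' L hj)
    refine ((hn.polyBounded.mul ⟨K, fun i => le_rfl⟩).comp fun p : Comp.Step n => p.1.1).mono
      fun s => ?_
    simp only [unary, List.length_replicate]
    refine (Finset.sum_le_card_nsmul _ _ ((M s.1.1 + 2) ^ K) fun k hk => ?_).trans ?_
    · exact hK ⟨(s.1.1, k), (Finset.mem_range.1 hk).trans s.2⟩
    · simp only [Finset.card_range, smul_eq_mul]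
      exact Nat.mul_le_mul_right _ s.2.le
  · intro Γ' L hj h
    exact (CompN.add (a := fun s : Comp.Step n => ∑ k ∈ Finset.range s.1.2, f s.1.1 k) h
      (hf Γ' L hj)).congr fun s => by rw [Finset.sum_range_succ]

theorem CompB.all {f : ι → ℕ → Bool} (hn : CompN M Γ n) (hf : StepB M Γ n f) :
    CompB M Γ fun i => decide (∀ j < n i, f i j = true) := by
  have h : CompN M Γ fun i => ∑ j ∈ Finset.range (n i), if f i j then 0 else 1 :=
    CompN.sum hn fun Γ' L hj => CompN.ite (hf Γ' L hj) (CompN.const 0) (CompN.const 1)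
  refine (CompB.eq h (CompN.const 0)).congr fun i => ?_
  simp [Finset.sum_eq_zero_iff]

theorem CompN.count {f : ι → ℕ → Bool} (hn : CompN M Γ n)
    (hf : StepB M Γ n f) :
    CompN M Γ fun i => ((Finset.range (n i)).filter fun j => f i j).card :=
  (CompN.sum (f := fun i j => if f i j then 1 else 0) hn fun Γ' L hj =>
    CompN.ite (hf Γ' L hj) (CompN.const 1) (CompN.const 0)).congr fun i => by
      rw [Finset.card_filter]

/-- In unary the bound `hb` is indispensable. Through it the logarithmic size of S makes loops over
all masks possible. -/
theorem CompN.two_pow (hn : CompN M Γ n) (hb : PolyBounded M fun i => 2 ^ n i) :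
    CompN M Γ fun i => 2 ^ n i := by
  refine Comp.iter (acc := fun _ j => unary (2 ^ j)) hn (CompN.const 1) ?_ ?_
  · refine (hb.comp fun p : Comp.Step n => p.1.1).mono fun p => ?_
    simpa [unary] using Nat.pow_le_pow_right (by omega) p.2.le
  · exact fun Γ' _ _ h => (CompN.add (a := fun p : Comp.Step n => 2 ^ p.1.2) h h).congr
      fun p => by rw [pow_succ]; ring

theorem CompN.half (ha : CompN M Γ a) : CompN M Γ fun i => a i / 2 := by
  refine (CompN.count (f := fun i j => decide (2 * (j + 1) ≤ a i)) ha fun Γ' L hj =>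
    CompB.le ((CompN.const 2).mul hj.succ) (L.nat ha)).congr fun i => ?_
  rw [show (Finset.range (a i)).filter (fun j => decide (2 * (j + 1) ≤ a i) = true) =
    Finset.range (a i / 2) by ext j; simp; omega, Finset.card_range]

theorem CompB.odd (ha : CompN M Γ a) : CompB M Γ fun i => decide (a i % 2 = 1) :=
  (CompB.eq (ha.sub ((CompN.const 2).mul ha.half)) (CompN.const 1)).congr fun i => by
    congr 1; rw [eq_iff_iff]; omega

theorem CompB.testBit (ha : CompN M Γ a) (hn : CompN M Γ n) :
    CompB M Γ fun i => (a i).testBit (n i) := by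
  have h : CompN M Γ fun i => a i / 2 ^ n i := by
    refine Comp.iter (acc := fun i j => unary (a i / 2 ^ j)) hn (Comp.congr ha (by simp)) ?_ ?_
    · refine (ha.polyBounded.comp fun p : Comp.Step n => p.1.1).mono fun p => ?_
      simpa [unary] using Nat.div_le_self _ _
    · exact fun Γ' _ _ h => (CompN.half (a := fun p : Comp.Step n => a p.1.1 / 2 ^ p.1.2) h).congr
        fun p => by rw [pow_succ, Nat.div_div_eq_div_mul]
  exact (CompB.odd h).congr fun i => by rw [Nat.testBit_eq_decide_div_mod_eq]

end Closure
/-! ### Bit strings and circuits -/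

/-- The bit `q` of a bit string, 0 beyond its end. -/
def bit {n : ℕ} (x : Bits n) (q : ℕ) : Bool := if h : q < n then x ⟨q, h⟩ else false

theorem bit_of_lt {n : ℕ} (x : Bits n) {q : ℕ} (h : q < n) : bit x q = x ⟨q, h⟩ := dif_pos h

theorem bit_val {n : ℕ} (x : Bits n) (q : Fin n) : bit x q = x q := bit_of_lt x q.2

theorem getD_word {n : ℕ} (x : Bits n) (q : ℕ) : (word x).getD q false = bit x q := by
  unfold word bit
  split_ifs with h <;> simp [h]

theorem word_eq_map {n : ℕ} (x : Bits n) : word x = (List.range n).map (bit x) := by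
  refine List.ext_getElem (by simp [word]) fun q h _ => ?_
  simp [word] at h
  simp [word, bit, h]

theorem CompB.bit {ι : Type} {M : ι → ℕ} {Γ : List (ι → List Bool)} {N q : ι → ℕ}
    {x : ∀ i, Bits (N i)} (hx : Comp M Γ fun i => word (x i)) (hq : CompN M Γ q) :
    CompB M Γ fun i => HCmQ.bit (x i) (q i) :=
  (CompB.getD hx hq).congr fun _ => getD_word _ _

theorem Comp.word {ι : Type} {M : ι → ℕ} {Γ : List (ι → List Bool)} {N : ι → ℕ}
    {x : ∀ i, Bits (N i)} {f : ι → ℕ → Bool} (hN : CompN M Γ N)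
    (hf : StepB M Γ N f) (e : ∀ i (q : Fin (N i)), x i q = f i q) :
    Comp M Γ fun i => HCmQ.word (x i) :=
  (Comp.tabulate hN hf).congr fun i => by
    rw [word_eq_map]
    refine List.map_congr_left fun q hq => ?_
    rw [bit_of_lt _ (List.mem_range.1 hq), e]

/-- The bits after the gate number `k` of the circuit with description `E` has acted. -/
def stepBits {N : ℕ} (E : List Bool) (k : ℕ) (w : Bits N) : Bits N := fun q =>
  w q ^^ (E.getD (2 * N * k + (2 * q + 1)) false &&
    decide (∀ j < N, (!E.getD (2 * N * k + 2 * j) false || bit w j) = true))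

theorem getD_encode_gate {N : ℕ} (g : Gate N) (q : Fin N) :
    g.encode.getD (2 * q) false = decide (q ∈ g.controls) ∧
    g.encode.getD (2 * q + 1) false = decide (q = g.target) := by
  have key : ∀ (l : List (Fin N)) (j : ℕ) (hj : j < l.length),
      (l.flatMap fun i => [decide (i ∈ g.controls), decide (i = g.target)]).getD (2 * j) false =
        decide (l[j] ∈ g.controls) ∧
      (l.flatMap fun i => [decide (i ∈ g.controls), decide (i = g.target)]).getD (2 * j + 1) false =
        decide (l[j] = g.target) := by
    intro l
    induction l with
    | nil => intro j hj; simp at hj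
    | cons a l ih =>
      rintro (_ | j) hj
      · simp
      · have := ih j (by simpa using hj)
        rw [show 2 * (j + 1) = 2 * j + 1 + 1 by ring]
        simpa using this
  simpa [Gate.encode] using key (List.finRange N) q (by simp)

theorem length_encode_gate {N : ℕ} (g : Gate N) : g.encode.length = 2 * N := by
  simp [Gate.encode, List.length_flatMap, mul_comm]

/-- All gate descriptions have length `2 * N`, so gate `k` starts at position `2 * N * k`. Beyond
the last gate only the default `false` is read. -/
theorem getD_encode {N : ℕ} (C : Circuit N) (k r : ℕ) (hr : r < 2 * N) :
    C.encode.getD (2 * N * k + r) false =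
      if h : k < C.length then C[k].encode.getD r false else false := by
  induction C generalizing k with
  | nil => simp [Circuit.encode]
  | cons g C ih =>
    have hE : Circuit.encode (g :: C) = g.encode ++ Circuit.encode C := rfl
    rw [hE]
    rcases k with _ | k
    · rw [List.getD_append _ _ _ _ (by rw [length_encode_gate]; omega)]
      simp
    · rw [List.getD_append_right _ _ _ _ (by rw [length_encode_gate]; nlinarith),
        length_encode_gate, show 2 * N * (k + 1) + r - 2 * N = 2 * N * k + r by
          rw [mul_add]; omega, ih]
      simp

/-- A gate has a target, so `N` is positive and its description nonempty. The length of the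
description thus serves as a number of rounds, and the gates need not be counted. -/
theorem length_le_length_encode {N : ℕ} (C : Circuit N) : C.length ≤ C.encode.length := by
  induction C with
  | nil => simp
  | cons g C ih =>
    have hE : Circuit.encode (g :: C) = g.encode ++ Circuit.encode C := rfl
    have := g.target.pos
    rw [hE, List.length_append, length_encode_gate, List.length_cons]
    omega

/-- A gate number beyond the circuit reads no target bit, so the surplus rounds of a simulation act
as the identity. -/
theorem stepBits_encode {N : ℕ} (C : Circuit N) (k : ℕ) (w : Bits N) :
    stepBits C.encode k w = if h : k < C.length then C[k].apply w else w := by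
  funext q
  unfold stepBits
  rw [getD_encode _ _ _ (by omega)]
  split_ifs with h
  · have e : decide (∀ j < N, (!C.encode.getD (2 * N * k + 2 * j) false || bit w j) = true) =
        decide (∀ i ∈ C[k].controls, w i = true) := by
      rw [decide_eq_decide]
      constructor
      · intro H i hi
        have := H i i.2
        rw [getD_encode _ _ _ (by omega), dif_pos h, (getD_encode_gate _ _).1, bit_val] at this
        simpa [hi] using this
      · intro H j hj
        rw [getD_encode _ _ _ (by omega), dif_pos h, bit_of_lt _ hj,
          (getD_encode_gate _ ⟨j, hj⟩).1]
        by_cases hc : (⟨j, hj⟩ : Fin N) ∈ C[k].controls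
        · simp [H _ hc]
        · simp [hc]
    rw [e, (getD_encode_gate _ _).2]
    unfold Gate.apply
    by_cases h1 : ∀ i ∈ C[k].controls, w i = true
    · rw [if_pos h1, decide_eq_true h1]
      by_cases h2 : q = C[k].target
      · subst h2; simp
      · simp [h2]
    · rw [if_neg h1, decide_eq_false h1]; simp
  · simp

/-- The bits after the first `k` gates. -/
def runBits {N : ℕ} (E : List Bool) (w : Bits N) : ℕ → Bits N
  | 0 => w
  | k + 1 => stepBits E k (runBits E w k)

/-- The bits after the last `k` gates were undone, of as many as there are bits in `E`. -/
def undoBits {N : ℕ} (E : List Bool) (w : Bits N) : ℕ → Bits N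
  | 0 => w
  | k + 1 => stepBits E (E.length - 1 - k) (undoBits E w k)

theorem Circuit.perm_append {N : ℕ} (C D : Circuit N) :
    Circuit.perm (C ++ D) = C.perm.trans D.perm := by
  induction C with
  | nil => rfl
  | cons g C ih =>
    rw [List.cons_append, Circuit.perm, ih]
    rfl

theorem runBits_encode {N : ℕ} (C : Circuit N) (w : Bits N) :
    runBits C.encode w C.encode.length = C.perm w := by
  have key : ∀ k, runBits C.encode w k = Circuit.perm (C.take k) w := by
    intro k
    induction k with
    | zero => simp [runBits, Circuit.perm]
    | succ k ih =>
      rw [runBits, stepBits_encode, ih]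
      split_ifs with h
      · rw [List.take_succ_eq_append_getElem h, Circuit.perm_append]
        rfl
      · rw [List.take_of_length_le (by omega), List.take_of_length_le (by omega)]
  rw [key, List.take_of_length_le (length_le_length_encode C)]

theorem undoBits_encode {N : ℕ} (C : Circuit N) (w : Bits N) :
    undoBits C.encode w C.encode.length = C.perm.symm w := by
  have key : ∀ k ≤ C.encode.length,
      undoBits C.encode w k = (Circuit.perm (C.drop (C.encode.length - k))).symm w := by
    intro k hk
    induction k with
    | zero =>
      rw [Nat.sub_zero, List.drop_eq_nil_of_le (length_le_length_encode C)]
      rfl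
    | succ k ih =>
      rw [undoBits, stepBits_encode, ih (by omega),
        show C.encode.length - 1 - k = C.encode.length - (k + 1) by omega]
      split_ifs with h
      -- A gate is its own inverse, so undoing it means applying it once more.
      · rw [List.drop_eq_getElem_cons h,
          show C.encode.length - (k + 1) + 1 = C.encode.length - k by omega]
        rfl
      · rw [List.drop_eq_nil_of_le (by omega), List.drop_eq_nil_of_le (by omega)]
  rw [key _ le_rfl, Nat.sub_self, List.drop_zero]

section

variable {ι : Type} {M : ι → ℕ} {Γ : List (ι → List Bool)} {N : ι → ℕ} {E : ι → List Bool}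
  {w : ∀ i, Bits (N i)} {k : ι → ℕ}

theorem Comp.stepBits (hN : CompN M Γ N) (hE : Comp M Γ E) (hk : CompN M Γ k)
    (hw : Comp M Γ fun i => HCmQ.word (w i)) :
    Comp M Γ fun i => HCmQ.word (stepBits (E i) (k i) (w i)) := by
  have h2 : ∀ {ι : Type} {M : ι → ℕ} {Γ : List (ι → List Bool)}, CompN M Γ fun _ => 2 :=
    CompN.const 2
  refine Comp.word (f := fun i q => bit (w i) q ^^ ((E i).getD (2 * N i * k i + (2 * q + 1)) false &&
    decide (∀ j < N i, (!(E i).getD (2 * N i * k i + 2 * j) false || bit (w i) j) = true))) hN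
    (fun Γ' L hq => ?_) fun i q => by rw [HCmQ.stepBits, bit_val]
  refine ((CompB.bit (L _ hw) hq).xor ((CompB.getD (L _ hE) (((h2.mul (L.nat hN)).mul
    (L.nat hk)).add (h2.mul hq).succ)).and (CompB.all (L.nat hN) fun Γ'' L' hj => ?_)))
  exact (CompB.getD (L' _ (L _ hE)) (((h2.mul (L'.nat (L.nat hN))).mul (L'.nat (L.nat hk))).add
    (h2.mul hj))).not.or (CompB.bit (L' _ (L _ hw)) hj)

theorem Comp.runBits (hN : CompN M Γ N) (hE : Comp M Γ E)
    (hw : Comp M Γ fun i => HCmQ.word (w i)) :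
    Comp M Γ fun i => HCmQ.word (runBits (E i) (w i) (E i).length) := by
  refine Comp.iter_length (acc := fun i j => HCmQ.word (HCmQ.runBits (E i) (w i) j)) hE
    (fun _ => rfl) hw ?_ fun Γ' L hj h => Comp.stepBits (L.nat hN) (L _ hE) hj h
  refine (hN.polyBounded.comp fun p : Comp.Step fun i => (E i).length => p.1.1).mono fun p => ?_
  simp [HCmQ.word]

theorem Comp.undoBits (hN : CompN M Γ N) (hE : Comp M Γ E)
    (hw : Comp M Γ fun i => HCmQ.word (w i)) :
    Comp M Γ fun i => HCmQ.word (undoBits (E i) (w i) (E i).length) := by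
  refine Comp.iter_length (acc := fun i j => HCmQ.word (HCmQ.undoBits (E i) (w i) j)) hE
    (fun _ => rfl) hw ?_ fun Γ' L hj h => Comp.stepBits (L.nat hN) (L _ hE)
      (((L.nat (CompN.length hE)).sub (CompN.const 1)).sub hj) h
  refine (hN.polyBounded.comp fun p : Comp.Step fun i => (E i).length => p.1.1).mono fun p => ?_
  simp [HCmQ.word]

end
/-! ### The sampling algorithm -/

/-- The bits of the characteristic word of a set of qubits. -/
def charBits {N : ℕ} (S : Finset (Fin N)) : Bits N := fun i => decide (i ∈ S)

/-- The number of qubits of `S` before the qubit `q`. -/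
def rank {N : ℕ} (S : Finset (Fin N)) (q : ℕ) : ℕ :=
  ((Finset.range q).filter fun j => bit (charBits S) j).card

/-- The bits of `τ` on the qubits of `S` that carry Hadamard gates, 0 elsewhere. -/
def mask {N : ℕ} (m : ℕ) (S : Finset (Fin N)) (τ : ℕ) : Bits N := fun q =>
  decide ((q : ℕ) < N - m) && (charBits S q && τ.testBit (rank S q))

/-- The bitwise exclusive or. -/
def bxor {N : ℕ} (u v : Bits N) : Bits N := fun q => u q ^^ v q

/-- Whether the last `m` bits of `w` are 0. -/
def ancillaZero {N : ℕ} (m : ℕ) (w : Bits N) : Bool :=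
  decide (∀ j < N, (!decide (N - m ≤ j) || !bit w j) = true)

/-- Whether `u`, with the bits of `τ` added, comes from an input with the last `m` bits 0. -/
def good {N : ℕ} (m : ℕ) (C : Circuit N) (S : Finset (Fin N)) (u : Bits N) (τ : ℕ) : Bool :=
  ancillaZero m (C.perm.symm (bxor u (mask m S τ)))

/-- The inner product modulo 2 of the first `a` bits of two numbers. -/
def parity (a ζ τ : ℕ) : Bool :=
  decide (((Finset.range a).filter fun j => ζ.testBit j && τ.testBit j).card % 2 = 1)

/-- How many `τ < 2 ^ a` with `g τ` have inner product `c` with `ζ`. -/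
def parityCount (a : ℕ) (g : ℕ → Bool) (ζ : ℕ) (c : Bool) : ℕ :=
  ((Finset.range (2 ^ a)).filter fun τ => g τ && !(parity a ζ τ ^^ c)).card

/-- The square of the Walsh coefficient of `g` at `ζ`. -/
def weight (a : ℕ) (g : ℕ → Bool) (ζ : ℕ) : ℕ :=
  ((parityCount a g ζ false - parityCount a g ζ true) +
    (parityCount a g ζ true - parityCount a g ζ false)) *
  ((parityCount a g ζ false - parityCount a g ζ true) +
    (parityCount a g ζ true - parityCount a g ζ false))

/-- The sum of all weights. -/
def total (a : ℕ) (g : ℕ → Bool) : ℕ := ∑ ζ ∈ Finset.range (2 ^ a), weight a g ζ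

/-- The number with the binary digits `b 0, b 1, …, b (j - 1)`, modulo `D`. -/
def digitsMod (D : ℕ) (b : ℕ → Bool) : ℕ → ℕ
  | 0 => 0
  | j + 1 =>
    if decide (D ≤ 2 * digitsMod D b j + if b j then 1 else 0) then
      2 * digitsMod D b j + (if b j then 1 else 0) - D
    else 2 * digitsMod D b j + if b j then 1 else 0

/-- The `ζ` such that `R` lies in the interval of length `weight a g ζ`, when the intervals are
laid out one after the other. -/
def select (a : ℕ) (g : ℕ → Bool) (R : ℕ) : ℕ :=
  ((Finset.range (2 ^ a)).filter fun ζ =>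
    decide (∑ ζ' ∈ Finset.range (ζ + 1), weight a g ζ' ≤ R)).card

/-- The bits of `ζ` on the qubits of `S` that carry Hadamard gates, those of `u` on the qubits
without. -/
def sampleBits {N : ℕ} (m : ℕ) (S : Finset (Fin N)) (u : Bits N) (ζ : ℕ) : Bits N := fun q =>
  if decide ((q : ℕ) < N - m) then ζ.testBit (rank S q) else u q

/-- The input of the circuit with coin flips on the first `N - m` bits. -/
def coinInput {N P : ℕ} (m : ℕ) (ρ : Bits P) : Bits N := fun q =>
  decide ((q : ℕ) < N - m) && bit ρ q

/-- The bit string whose bits in `S` the algorithm returns. -/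
def sample {N P : ℕ} (m : ℕ) (C : Circuit N) (S : Finset (Fin N)) (ρ : Bits P) : Bits N :=
  sampleBits m S (C.perm (coinInput m ρ)) (select (rank S (N - m))
    (good m C S (C.perm (coinInput m ρ)))
    (digitsMod (total (rank S (N - m)) (good m C S (C.perm (coinInput m ρ))))
      (fun j => bit ρ (N + j)) (P - N)))

section

variable {ι : Type} {M : ι → ℕ} {Γ : List (ι → List Bool)} {a ζ τ R D : ι → ℕ}
  {g : ι → ℕ → Bool}

/-- The computable families of Boolean functions of a number. -/
def CompFun (M : ι → ℕ) (Γ : List (ι → List Bool)) (g : ι → ℕ → Bool) : Prop :=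
  ∀ (ι' : Type) (π : ι' → ι) (Γ' : List (ι' → List Bool)) (n : ι' → ℕ), Lift M Γ π Γ' →
    CompN (fun p => M (π p)) Γ' n → CompB (fun p => M (π p)) Γ' fun p => g (π p) (n p)

/-- As `CompFun` quantifies over all contexts, such a function can be evaluated inside nested loops
at arguments that depend on the loop variables. -/
theorem CompFun.lift (hg : CompFun M Γ g) {ι' : Type} {π : ι' → ι} {Γ' : List (ι' → List Bool)}
    (L : Lift M Γ π Γ') : CompFun (fun p => M (π p)) Γ' fun p => g (π p) :=
  fun _ π' _ _ L' hn => hg _ (fun p => π (π' p)) _ _ (fun _ hf => L' _ (L _ hf)) hn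

theorem CompFun.app (hg : CompFun M Γ g) (hτ : CompN M Γ τ) : CompB M Γ fun i => g i (τ i) :=
  hg _ (fun i => i) _ _ (fun _ hf => hf) hτ

theorem CompB.parity (ha : CompN M Γ a) (hζ : CompN M Γ ζ) (hτ : CompN M Γ τ) :
    CompB M Γ fun i => HCmQ.parity (a i) (ζ i) (τ i) :=
  CompB.odd (CompN.count ha fun _ L hj =>
    (CompB.testBit (L.nat hζ) hj).and (CompB.testBit (L.nat hτ) hj))

theorem CompN.parityCount (ha : CompN M Γ a) (hb : PolyBounded M fun i => 2 ^ a i)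
    (hg : CompFun M Γ g) (hζ : CompN M Γ ζ) (c : Bool) :
    CompN M Γ fun i => HCmQ.parityCount (a i) (g i) (ζ i) c :=
  CompN.count (ha.two_pow hb) fun _ L hj => ((hg.lift L).app hj).and
    (((CompB.parity (L.nat ha) (L.nat hζ) hj).xor (CompB.const c)).not)

theorem CompN.weight (ha : CompN M Γ a) (hb : PolyBounded M fun i => 2 ^ a i)
    (hg : CompFun M Γ g) (hζ : CompN M Γ ζ) :
    CompN M Γ fun i => HCmQ.weight (a i) (g i) (ζ i) := by
  have h := CompN.parityCount ha hb hg hζ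
  have h' := ((h false).sub (h true)).add ((h true).sub (h false))
  exact h'.mul h'

theorem CompN.total (ha : CompN M Γ a) (hb : PolyBounded M fun i => 2 ^ a i)
    (hg : CompFun M Γ g) : CompN M Γ fun i => HCmQ.total (a i) (g i) :=
  CompN.sum (ha.two_pow hb) fun _ L hj =>
    CompN.weight (L.nat ha) (hb.comp _) (hg.lift L) hj

theorem CompN.select (ha : CompN M Γ a) (hb : PolyBounded M fun i => 2 ^ a i)
    (hg : CompFun M Γ g) (hR : CompN M Γ R) :
    CompN M Γ fun i => HCmQ.select (a i) (g i) (R i) :=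
  CompN.count (ha.two_pow hb) fun _ L hj => CompB.le (CompN.sum hj.succ fun _ L' hj' =>
    CompN.weight (L'.nat (L.nat ha)) ((hb.comp _).comp _) ((hg.lift L).lift L') hj') (L.nat hR)

/-- Doubling a number below `D` and adding a bit stays below `2 * D`, so one subtraction suffices.
Reducing after every digit keeps the numbers small enough for unary notation. -/
theorem digitsMod_lt {D : ℕ} (hD : 0 < D) (b : ℕ → Bool) (j : ℕ) : digitsMod D b j < D := by
  induction j with
  | zero => exact hD
  | succ j ih =>
    rw [digitsMod]
    simp only [decide_eq_true_eq]
    split_ifs <;> omega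

theorem CompN.digitsMod {b : ι → ℕ → Bool} {n : ι → ℕ} (hD : CompN M Γ D) (hD' : ∀ i, 0 < D i)
    (hb : CompFun M Γ b) (hn : CompN M Γ n) :
    CompN M Γ fun i => HCmQ.digitsMod (D i) (b i) (n i) := by
  refine Comp.iter (acc := fun i j => unary (HCmQ.digitsMod (D i) (b i) j)) hn Comp.nil ?_ ?_
  · refine (hD.polyBounded.comp fun p : Comp.Step n => p.1.1).mono fun p => ?_
    simpa [unary] using (digitsMod_lt (hD' _) _ _).le
  · intro Γ' L hj h
    have h' : CompN (fun p : Comp.Step n => M p.1.1) Γ' fun p =>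
        2 * HCmQ.digitsMod (D p.1.1) (b p.1.1) p.1.2 + if b p.1.1 p.1.2 then 1 else 0 :=
      CompN.add (CompN.mul (CompN.const 2) h)
        (CompN.ite ((hb.lift L).app hj) (CompN.const 1) (CompN.const 0))
    exact CompN.ite (CompB.le (L.nat hD) h') (h'.sub (L.nat hD)) h'

variable {N m : ι → ℕ} {S : ∀ i, Finset (Fin (N i))} {u : ∀ i, Bits (N i)}

theorem CompN.rank (hS : Comp M Γ fun i => setWord (S i)) (hτ : CompN M Γ τ) :
    CompN M Γ fun i => HCmQ.rank (S i) (τ i) :=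
  CompN.count hτ fun _ L hj =>
    CompB.bit (x := fun p => charBits (S p.1.1)) (L _ hS) hj

theorem Comp.bxor_mask (hN : CompN M Γ N) (hm : CompN M Γ m) (hS : Comp M Γ fun i => setWord (S i))
    (hu : Comp M Γ fun i => HCmQ.word (u i)) (hτ : CompN M Γ τ) :
    Comp M Γ fun i => HCmQ.word (bxor (u i) (mask (m i) (S i) (τ i))) := by
  refine Comp.word (f := fun i q => bit (u i) q ^^ (decide (q < N i - m i) &&
    (bit (charBits (S i)) q && (τ i).testBit (HCmQ.rank (S i) q)))) hN (fun Γ' L hq => ?_)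
    fun i q => by rw [bit_val, bit_val]; rfl
  exact (CompB.bit (L _ hu) hq).xor ((CompB.lt hq ((L.nat hN).sub (L.nat hm))).and
    ((CompB.bit (x := fun p : Comp.Step N => charBits (S p.1.1)) (L _ hS) hq).and
      (CompB.testBit (L.nat hτ) (CompN.rank (L _ hS) hq))))

theorem CompB.ancillaZero (hN : CompN M Γ N) (hm : CompN M Γ m)
    (hu : Comp M Γ fun i => HCmQ.word (u i)) : CompB M Γ fun i => HCmQ.ancillaZero (m i) (u i) :=
  CompB.all hN fun _ L hj => (CompB.le ((L.nat hN).sub (L.nat hm)) hj).not.or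
    (CompB.bit (L _ hu) hj).not

theorem CompFun.good {C : ∀ i, Circuit (N i)} (hN : CompN M Γ N) (hm : CompN M Γ m)
    (hS : Comp M Γ fun i => setWord (S i)) (hC : Comp M Γ fun i => (C i).encode)
    (hu : Comp M Γ fun i => HCmQ.word (u i)) :
    CompFun M Γ fun i => HCmQ.good (m i) (C i) (S i) (u i) := by
  intro ι' π Γ' n L hn
  refine CompB.ancillaZero (L.nat hN) (L.nat hm) ?_
  exact (Comp.undoBits (L.nat hN) (L _ hC) (Comp.bxor_mask (S := fun p => S (π p))
    (u := fun p => u (π p)) (L.nat hN) (L.nat hm) (L _ hS) (L _ hu) hn)).congr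
      fun p => by rw [undoBits_encode]

theorem Comp.sampleBits (hN : CompN M Γ N) (hm : CompN M Γ m)
    (hS : Comp M Γ fun i => setWord (S i)) (hu : Comp M Γ fun i => HCmQ.word (u i))
    (hζ : CompN M Γ ζ) : Comp M Γ fun i => HCmQ.word (sampleBits (m i) (S i) (u i) (ζ i)) := by
  refine Comp.word (f := fun i q => if decide (q < N i - m i) then
    (ζ i).testBit (HCmQ.rank (S i) q) else bit (u i) q) hN (fun Γ' L hq => ?_)
    fun i q => by rw [bit_val]; rfl
  exact (CompB.lt hq ((L.nat hN).sub (L.nat hm))).ite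
    (CompB.testBit (L.nat hζ) (CompN.rank (L _ hS) hq)) (CompB.bit (L _ hu) hq)

theorem Comp.coinInput {P : ι → ℕ} {ρ : ∀ i, Bits (P i)} (hN : CompN M Γ N) (hm : CompN M Γ m)
    (hρ : Comp M Γ fun i => HCmQ.word (ρ i)) :
    Comp M Γ fun i => HCmQ.word (coinInput (m i) (ρ i) : Bits (N i)) :=
  Comp.word (f := fun i q => decide (q < N i - m i) && bit (ρ i) q) hN (fun _ L hq =>
    (CompB.lt hq ((L.nat hN).sub (L.nat hm))).and (CompB.bit (L _ hρ) hq)) fun _ _ => rfl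

theorem Comp.sample {P : ι → ℕ} {ρ : ∀ i, Bits (P i)} {C : ∀ i, Circuit (N i)}
    (hN : CompN M Γ N) (hm : CompN M Γ m)
    (hS : Comp M Γ fun i => setWord (S i)) (hC : Comp M Γ fun i => (C i).encode)
    (hρ : Comp M Γ fun i => HCmQ.word (ρ i))
    (hb : PolyBounded M fun i => 2 ^ HCmQ.rank (S i) (N i - m i))
    (hT : ∀ i, 0 < total (HCmQ.rank (S i) (N i - m i))
      (good (m i) (C i) (S i) ((C i).perm (HCmQ.coinInput (m i) (ρ i))))) :
    Comp M Γ fun i => HCmQ.word (sample (m i) (C i) (S i) (ρ i)) := by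
  have hu : Comp M Γ fun i => HCmQ.word ((C i).perm (HCmQ.coinInput (m i) (ρ i))) :=
    (Comp.runBits hN hC (Comp.coinInput hN hm hρ)).congr fun i => by rw [runBits_encode]
  have hg := CompFun.good (u := fun i => (C i).perm (HCmQ.coinInput (m i) (ρ i))) hN hm hS hC hu
  have ha := CompN.rank hS (hN.sub hm)
  refine Comp.sampleBits hN hm hS hu (CompN.select ha hb hg (CompN.digitsMod
    (CompN.total ha hb hg) hT ?_ ?_))
  · exact fun ι' π Γ' n L hn => CompB.bit (x := fun p => ρ (π p)) (L _ hρ) ((L.nat hN).add hn)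
  · exact (CompN.sub (CompN.length hρ) hN).congr fun i => by simp [HCmQ.word]

end

/-- The results on the qubits of `S`, as a word. -/
theorem word_readout {N : ℕ} (S : Finset (Fin N)) (w : Bits N) :
    word (readout S w) = ((List.range N).filter (bit (charBits S))).map (bit w) := by
  have h : S.sort = (List.finRange N).filter fun i => decide (i ∈ S) := by
    refine List.Perm.eq_of_pairwise' (r := (· < ·)) ?_ ?_ ?_
    · exact S.sortedLT_sort.pairwise
    · exact (List.pairwise_lt_finRange N).filter _
    · refine (List.perm_ext_iff_of_nodup (S.sort_nodup _) ((List.nodup_finRange N).filter _)).2 ?_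
      simp
  rw [← List.map_coe_finRange_eq_range, List.filter_map, List.map_map]
  have h1 : bit w ∘ ((↑) : Fin N → ℕ) = w := funext fun i => bit_val w i
  have h2 : bit (charBits S) ∘ ((↑) : Fin N → ℕ) = fun i => decide (i ∈ S) :=
    funext fun i => bit_val _ i
  rw [h1, h2, ← h, ← S.listMap_orderEmbOfFin_finRange rfl, List.map_map, word, List.ofFn_eq_map]
  rfl

theorem Comp.readout {ι : Type} {M : ι → ℕ} {Γ : List (ι → List Bool)} {N : ι → ℕ}
    {S : ∀ i, Finset (Fin (N i))} {u : ∀ i, Bits (N i)} (hN : CompN M Γ N)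
    (hS : Comp M Γ fun i => setWord (S i)) (hu : Comp M Γ fun i => HCmQ.word (u i)) :
    Comp M Γ fun i => HCmQ.word (readout (S i) (u i)) :=
  (Comp.filterMap (p := fun i => bit (charBits (S i))) (f := fun i => bit (u i)) hN
    (fun _ L hj => CompB.bit (x := fun p => charBits (S p.1.1)) (L _ hS) hj)
    fun _ L hj => CompB.bit (x := fun p => u p.1.1) (L _ hu) hj).congr
      fun _ => (word_readout _ _).symm

/-! ### The output distribution of the quantum circuit -/

section

variable {N : ℕ} (m : ℕ) (C : Circuit N) (S : Finset (Fin N))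

/-- The qubits of `S` that carry Hadamard gates. -/
def hadamardPart : Finset (Fin N) := S.filter fun q => (q : ℕ) < N - m

/-- The bit strings that vanish outside the qubits of `S` with Hadamard gates. -/
def masks : Finset (Bits N) :=
  Finset.univ.filter fun T => ∀ q, T q = true → q ∈ hadamardPart m S

/-- The character `(-1)^(y · T)`. -/
noncomputable def chi (y T : Bits N) : ℝ := ∏ q, if y q && T q then -1 else 1

/-- The indicator of the basis states that occur when the circuit has acted. -/
noncomputable def occurs (v : Bits N) : ℝ := if ancillaZero m (C.perm.symm v) then 1 else 0

/-- The Walsh coefficient at `y` of the indicator of the basis states that occur, around `u`. -/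
noncomputable def walsh (u y : Bits N) : ℝ :=
  ∑ T ∈ masks m S, chi y T * occurs m C (bxor u T)

/-- The number of basis states that occur and differ from `u` by a mask. -/
noncomputable def cosetCount (u : Bits N) : ℝ := ∑ T ∈ masks m S, occurs m C (bxor u T)

/-- The indicator of agreement on the qubits of `S` without Hadamard gates. -/
noncomputable def agrees (y u : Bits N) : ℝ :=
  if ∀ q ∈ S, N - m ≤ (q : ℕ) → u q = y q then 1 else 0

/-- The entries of the one-qubit factors of the layer of Hadamard gates. -/
noncomputable def layerEntry (q : Fin N) (a b : Bool) : ℝ :=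
  if (q : ℕ) < N - m then (if a && b then -1 else 1) / Real.sqrt 2 else if a = b then 1 else 0

variable {m C S}

theorem bxor_bxor (u T : Bits N) : bxor (bxor u T) T = u := by
  funext q; simp [bxor]

theorem bxor_self_left (u T : Bits N) : bxor u (bxor u T) = T := by
  funext q; simp [bxor]

theorem bxor_assoc (u v w : Bits N) : bxor (bxor u v) w = bxor u (bxor v w) := by
  funext q; simp [bxor]

theorem sum_bxor {α : Type} [AddCommMonoid α] (T : Bits N) (f : Bits N → α) :
    ∑ v, f (bxor v T) = ∑ v, f v :=
  Equiv.sum_comp (Function.Involutive.toPerm (fun v => bxor v T) fun v => bxor_bxor v T) f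

theorem sum_bxor_left {α : Type} [AddCommMonoid α] (u : Bits N) (f : Bits N → α) :
    ∑ v, f (bxor u v) = ∑ v, f v :=
  Equiv.sum_comp (Function.Involutive.toPerm (fun v => bxor u v) fun v => bxor_self_left u v) f

theorem bxor_mem_masks {T T' : Bits N} (h : T ∈ masks m S) (h' : T' ∈ masks m S) :
    bxor T T' ∈ masks m S := by
  simp only [masks, Finset.mem_filter, Finset.mem_univ, true_and] at h h' ⊢
  intro q hq
  by_cases h1 : T q = true
  · exact h q h1
  · exact h' q (by simpa [bxor, h1] using hq)

theorem sum_masks_bxor {T : Bits N} (hT : T ∈ masks m S) (f : Bits N → ℝ) :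
    ∑ v ∈ masks m S, f (bxor T v) = ∑ v ∈ masks m S, f v :=
  Finset.sum_bij' (fun v _ => bxor T v) (fun v _ => bxor T v) (fun _ hv => bxor_mem_masks hT hv)
    (fun _ hv => bxor_mem_masks hT hv) (fun _ _ => bxor_self_left _ _)
    (fun _ _ => bxor_self_left _ _) fun _ _ => rfl

theorem chi_bxor (y T T' : Bits N) : chi y (bxor T T') = chi y T * chi y T' := by
  simp only [chi, ← Finset.prod_mul_distrib]
  refine Finset.prod_congr rfl fun q _ => ?_
  cases y q <;> cases h : T q <;> cases h' : T' q <;> simp [bxor, h, h']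

/-- Moving the centre within its coset changes only a sign, so the square of the coefficient depends
on the coset alone. -/
theorem walsh_bxor (u y : Bits N) {T : Bits N} (hT : T ∈ masks m S) :
    walsh m C S (bxor u T) y = chi y T * walsh m C S u y := by
  rw [walsh, ← sum_masks_bxor hT, walsh, Finset.mul_sum]
  refine Finset.sum_congr rfl fun T' _ => ?_
  rw [chi_bxor, bxor_assoc, bxor_self_left, mul_assoc]

theorem cosetCount_bxor (u : Bits N) {T : Bits N} (hT : T ∈ masks m S) :
    cosetCount m C S (bxor u T) = cosetCount m C S u := by
  rw [cosetCount, ← sum_masks_bxor hT, cosetCount]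
  refine Finset.sum_congr rfl fun T' _ => ?_
  rw [bxor_assoc, bxor_self_left]

theorem occurs_nonneg (v : Bits N) : 0 ≤ occurs m C v := by
  unfold occurs; split_ifs <;> simp

theorem occurs_le_one (v : Bits N) : occurs m C v ≤ 1 := by
  unfold occurs; split_ifs <;> simp

theorem occurs_mul_self (v : Bits N) : occurs m C v * occurs m C v = occurs m C v := by
  unfold occurs; split_ifs <;> simp

theorem zero_mem_masks : (fun _ => false) ∈ masks m S := by simp [masks]

theorem cosetCount_pos {u : Bits N} (h : ancillaZero m (C.perm.symm u) = true) :
    0 < cosetCount m C S u := by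
  refine Finset.sum_pos' (fun T _ => occurs_nonneg _) ⟨fun _ => false, zero_mem_masks, ?_⟩
  have : bxor u (fun _ => false) = u := by funext q; simp [bxor]
  rw [this, occurs, if_pos h]
  exact one_pos

theorem agrees_bxor (y u : Bits N) {T : Bits N} (hT : T ∈ masks m S) :
    agrees m S y (bxor u T) = agrees m S y u := by
  simp only [masks, Finset.mem_filter, Finset.mem_univ, true_and, hadamardPart] at hT
  unfold agrees
  congr 1
  rw [eq_iff_iff]
  refine forall₃_congr fun q hq hm => ?_
  have : T q = false := by
    by_contra h
    have := (hT q (by simpa using h)).2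
    omega
  simp [bxor, this]

/-- Averaged over the basis states that occur, the Walsh coefficient equals its square divided by
the size of the coset. -/
theorem sum_walsh_eq (y : Bits N) :
    ∑ v, occurs m C v * agrees m S y v * walsh m C S v y =
      ∑ v, occurs m C v * agrees m S y v * (walsh m C S v y ^ 2 / cosetCount m C S v) := by
  -- Expand one of the two factors by definition; its characters are absorbed by the other factor,
  -- whose centre they shift.
  have h1 : ∀ v, walsh m C S v y ^ 2 =
      ∑ T ∈ masks m S, occurs m C (bxor v T) * walsh m C S (bxor v T) y := by
    intro v
    rw [sq]
    nth_rewrite 1 [walsh]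
    rw [Finset.sum_mul]
    refine Finset.sum_congr rfl fun T hT => ?_
    rw [walsh_bxor v y hT]
    ring
  -- Replace `v` by `bxor v T`. Agreement and coset size are invariant under masks, and afterwards
  -- the sum over `T` only counts the coset, which cancels the denominator.
  have h2 : ∑ v, occurs m C v * agrees m S y v * (walsh m C S v y ^ 2 / cosetCount m C S v) =
      ∑ T ∈ masks m S, ∑ v, occurs m C (bxor v T) * (occurs m C v * agrees m S y v *
        walsh m C S v y / cosetCount m C S v) := by
    simp only [h1, Finset.sum_div, Finset.mul_sum]
    rw [Finset.sum_comm]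
    refine Finset.sum_congr rfl fun T hT => ?_
    rw [← sum_bxor T]
    refine Finset.sum_congr rfl fun v _ => ?_
    rw [bxor_bxor, agrees_bxor y v hT, cosetCount_bxor v hT]
    ring
  rw [h2, Finset.sum_comm]
  refine Finset.sum_congr rfl fun v _ => ?_
  rw [← Finset.sum_mul]
  -- The coset count can vanish only where `occurs m C v` does, and there both sides are 0.
  by_cases h : ancillaZero m (C.perm.symm v) = true
  · have := (cosetCount_pos (S := S) h).ne'
    rw [show ∑ T ∈ masks m S, occurs m C (bxor v T) = cosetCount m C S v from rfl]
    field_simp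
  · simp [occurs, h]

/-! ### Factorisation over the qubits, orthogonality of characters, Parseval -/

theorem sum_prod_bits (f : Fin N → Bool → ℝ) :
    ∑ w : Bits N, ∏ q, f q (w q) = ∏ q, (f q true + f q false) := by
  rw [← Fintype.prod_sum]
  simp

/-- Together with `sum_prod_bits` this reduces sums over constrained bit strings to checks on single
qubits. -/
theorem prod_indicator (p : Fin N → Prop) [DecidablePred p] :
    (∏ q, if p q then (1 : ℝ) else 0) = if ∀ q, p q then 1 else 0 := by
  rw [Finset.prod_ite_zero]
  simp

theorem prod_hadamardPart (c : ℝ) :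
    (∏ q, if q ∈ hadamardPart m S then c else 1) = c ^ (hadamardPart m S).card := by
  rw [Finset.prod_ite_mem, Finset.univ_inter, Finset.prod_const]

theorem card_masks : ((masks m S).card : ℝ) = 2 ^ (hadamardPart m S).card := by
  have h := sum_prod_bits (N := N) fun q b => if b = true → q ∈ hadamardPart m S then 1 else 0
  simp only [prod_indicator] at h
  rw [masks, Finset.card_filter, ← prod_hadamardPart]
  push_cast
  rw [h]
  refine Finset.prod_congr rfl fun q _ => ?_
  split_ifs <;> simp_all
  norm_num

theorem sum_chi_mul_chi {T T' : Bits N} (hT : T ∈ masks m S) (hT' : T' ∈ masks m S) :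
    ∑ y ∈ masks m S, chi y T * chi y T' =
      if T = T' then 2 ^ (hadamardPart m S).card else 0 := by
  have h : ∑ y ∈ masks m S, chi y T * chi y T' = ∏ q, ((if q ∈ hadamardPart m S then
      (if T q then -1 else 1) * (if T' q then -1 else 1) else 0) + (1 : ℝ)) := by
    have := sum_prod_bits (N := N) fun q b => (if b = true → q ∈ hadamardPart m S then 1 else 0) *
      ((if b && T q then -1 else 1) * (if b && T' q then -1 else 1))
    simp only [Finset.prod_mul_distrib, prod_indicator] at this
    rw [masks, Finset.sum_filter]
    refine Eq.trans (Finset.sum_congr rfl fun y _ => ?_) (this.trans ?_)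
    · split_ifs <;> simp [chi]
    · refine Finset.prod_congr rfl fun q _ => ?_
      by_cases hq : q ∈ hadamardPart m S <;> simp [hq]
  rw [h]
  split_ifs with e
  · subst e
    rw [← prod_hadamardPart]
    refine Finset.prod_congr rfl fun q _ => ?_
    split_ifs <;> norm_num
  -- On a qubit where the masks differ, the two values of `y q` contribute opposite signs. One of
  -- the masks is 1 there, so `y q` is indeed free.
  · obtain ⟨q, hq⟩ := Function.ne_iff.1 e
    refine Finset.prod_eq_zero (Finset.mem_univ q) ?_
    simp only [masks, Finset.mem_filter, Finset.mem_univ, true_and] at hT hT'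
    have hm : q ∈ hadamardPart m S := by
      cases h1 : T q
      · exact hT' q (by rw [h1] at hq; simpa using hq.symm)
      · exact hT q h1
    rw [if_pos hm]
    cases h1 : T q <;> cases h2 : T' q <;> simp_all

/-- Parseval's identity, from the orthogonality of the characters and the idempotence of the
indicator. -/
theorem sum_walsh_sq (u : Bits N) :
    ∑ y ∈ masks m S, walsh m C S u y ^ 2 =
      2 ^ (hadamardPart m S).card * cosetCount m C S u := by
  have h : ∀ y, walsh m C S u y ^ 2 = ∑ T ∈ masks m S, ∑ T' ∈ masks m S,
      occurs m C (bxor u T) * occurs m C (bxor u T') * (chi y T * chi y T') := by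
    intro y
    rw [sq, walsh, Finset.sum_mul_sum]
    exact Finset.sum_congr rfl fun T _ => Finset.sum_congr rfl fun T' _ => by ring
  simp only [h]
  rw [Finset.sum_comm, cosetCount, Finset.mul_sum]
  refine Finset.sum_congr rfl fun T hT => ?_
  rw [Finset.sum_comm]
  simp only [← Finset.mul_sum]
  rw [Finset.sum_eq_single_of_mem T hT]
  · rw [sum_chi_mul_chi hT hT, if_pos rfl, occurs_mul_self, mul_comm]
  · intro T' hT' hne
    rw [sum_chi_mul_chi hT hT', if_neg hne.symm, mul_zero]

/-! ### Amplitudes and marginals of the circuit -/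

theorem hadamardLayer_apply (v w : Bits N) :
    hadamardLayer N m v w = ((∏ q, layerEntry m q (v q) (w q) : ℝ) : ℂ) := by
  rw [Complex.ofReal_prod, hadamardLayer, Matrix.of_apply]
  refine Finset.prod_congr rfl fun q _ => ?_
  unfold layerEntry hadamard
  by_cases h : (q : ℕ) < N - m
  · rw [if_pos h, if_pos h]
    simp only [Matrix.of_apply]
    split_ifs <;> simp
  · rw [if_neg h, if_neg h, Matrix.one_apply]
    split_ifs <;> simp

theorem ancillaZero_iff {v : Bits N} :
    ancillaZero m v = true ↔ ∀ q : Fin N, N - m ≤ (q : ℕ) → v q = false := by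
  rw [ancillaZero, decide_eq_true_eq]
  constructor
  · intro H q hq
    have := H q q.2
    simpa [hq, bit_val] using this
  · intro H j hj
    rw [bit_of_lt _ hj]
    by_cases hq : N - m ≤ j
    · simp [H ⟨j, hj⟩ hq]
    · simp [hq]

theorem prod_layerEntry_zero (hm : m ≤ N) (v : Bits N) :
    ∏ q, layerEntry m q (v q) false =
      (1 / Real.sqrt 2) ^ (N - m) * if ancillaZero m v then 1 else 0 := by
  have h : ∀ q : Fin N, layerEntry m q (v q) false = (if (q : ℕ) < N - m then 1 / Real.sqrt 2 else 1) *
      if N - m ≤ (q : ℕ) → v q = false then 1 else 0 := by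
    intro q
    unfold layerEntry
    by_cases hq : (q : ℕ) < N - m
    · simp [hq, Nat.not_le.2 hq]
    · simp [hq, Nat.not_lt.1 hq]
  simp only [h, Finset.prod_mul_distrib, prod_indicator]
  congr 1
  · rw [Finset.prod_ite, Finset.prod_const, Finset.prod_const_one, mul_one]
    congr 1
    have := Fin.card_filter_val_lt (n := N) (m := N - m)
    rw [this]
    omega
  · simp only [ancillaZero_iff]

/-- The first layer spreads the zero state evenly over the inputs with zero ancillas, and `C`
permutes basis states. The amplitudes are real, so squared norms are plain squares. -/
theorem finalState_eq (hm : m ≤ N) (w : Bits N) :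
    finalState m C w = ((∑ v, (∏ q, layerEntry m q (w q) (v q)) *
      ((1 / Real.sqrt 2) ^ (N - m) * occurs m C v) : ℝ) : ℂ) := by
  rw [finalState, Matrix.mulVec, dotProduct]
  push_cast
  refine Finset.sum_congr rfl fun v _ => ?_
  rw [hadamardLayer_apply]
  push_cast
  congr 1
  rw [Matrix.mulVec, dotProduct, Finset.sum_eq_single (C.perm.symm v)]
  · rw [Matrix.mulVec_single_one, Matrix.col_apply, hadamardLayer_apply, prod_layerEntry_zero hm]
    simp only [Circuit.unitary, Matrix.of_apply, Equiv.apply_symm_apply, if_true, one_mul, occurs]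
    push_cast
    rfl
  · intro w' _ hw'
    have : v ≠ C.perm w' := fun h => hw' (by rw [h, Equiv.symm_apply_apply])
    simp [Circuit.unitary, this]
  · simp

/-- The effect of measuring or discarding one qubit. Outside `S` the rows are orthonormal and force
`c = c'`; on a qubit of `S` with a Hadamard gate a sign and a factor 1/2 arise; on one without, both
bits equal the outcome. -/
theorem sum_layerEntry_mul (y : Bits N) (q : Fin N) (c c' : Bool) :
    ((if q ∈ S → true = y q then 1 else 0) * (layerEntry m q true c * layerEntry m q true c') +
      (if q ∈ S → false = y q then 1 else 0) * (layerEntry m q false c * layerEntry m q false c')) =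
    ((if q ∈ hadamardPart m S then 1 / 2 else 1) * (if y q && (c ^^ c') then -1 else 1)) *
      ((if (c ^^ c') = true → q ∈ hadamardPart m S then 1 else 0) *
      if q ∈ S → N - m ≤ (q : ℕ) → c = y q then 1 else 0) := by
  have h2 : (Real.sqrt 2)⁻¹ * (Real.sqrt 2)⁻¹ = 1 / 2 := by
    rw [← mul_inv, Real.mul_self_sqrt (by norm_num)]; norm_num
  have h3 : (Real.sqrt 2)⁻¹ * (Real.sqrt 2)⁻¹ + (Real.sqrt 2)⁻¹ * (Real.sqrt 2)⁻¹ = 1 := by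
    rw [h2]; norm_num
  by_cases hS : q ∈ S <;> by_cases hn : (q : ℕ) < N - m
  · have hq : q ∈ hadamardPart m S := by simp [hadamardPart, hS, hn]
    cases hy : y q <;> cases c <;> cases c' <;>
      simp [layerEntry, hS, hn, hq, Nat.not_le.2 hn, div_eq_mul_inv, h2]
  · have hq : q ∉ hadamardPart m S := by simp [hadamardPart, hn]
    cases hy : y q <;> cases c <;> cases c' <;>
      simp [layerEntry, hS, hn, hq, Nat.not_lt.1 hn]
  · have hq : q ∉ hadamardPart m S := by simp [hadamardPart, hS]
    cases hy : y q <;> cases c <;> cases c' <;>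
      simp [layerEntry, hS, hn, hq, div_eq_mul_inv, h3]
  · have hq : q ∉ hadamardPart m S := by simp [hadamardPart, hS]
    cases hy : y q <;> cases c <;> cases c' <;>
      simp [layerEntry, hS, hn, hq]

theorem readout_eq_iff (w y : Bits N) :
    readout S w = readout S y ↔ ∀ q, q ∈ S → w q = y q := by
  constructor
  · intro h q hq
    have : q ∈ Set.range (S.orderEmbOfFin rfl) := by rw [Finset.range_orderEmbOfFin]; exact hq
    obtain ⟨j, rfl⟩ := this
    exact congrFun h j
  · exact fun h => funext fun j => h _ (Finset.orderEmbOfFin_mem _ _ _)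

theorem exists_readout_eq (z : Bits S.card) : ∃ y : Bits N, readout S y = z :=
  (S.orderEmbOfFin rfl).injective.surjective_comp_right z

/-- Squaring the amplitude gives a sum over pairs `v`, `v'`. Summed over the results compatible with
`y`, a pair survives only if `v` and `v'` differ by a mask. -/
theorem marginalProb_readout (hm : m ≤ N) (y : Bits N) :
    marginalProb m C S (readout S y) = (1 / 2) ^ (N - m) * (1 / 2) ^ (hadamardPart m S).card *
      ∑ v, occurs m C v * agrees m S y v * walsh m C S v y := by
  have hout : ∀ w, outputProb m C w = ∑ v, ∑ v', (1 / 2) ^ (N - m) * (occurs m C v *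
      occurs m C v') * ∏ q, (layerEntry m q (w q) (v q) * layerEntry m q (w q) (v' q)) := by
    intro w
    rw [outputProb, finalState_eq hm, Complex.norm_real, Real.norm_eq_abs, sq_abs, sq,
      Finset.sum_mul_sum]
    refine Finset.sum_congr rfl fun v _ => Finset.sum_congr rfl fun v' _ => ?_
    have h2 : (1 / 2 : ℝ) ^ (N - m) = (1 / Real.sqrt 2) ^ (N - m) * (1 / Real.sqrt 2) ^ (N - m) := by
      rw [← mul_pow, div_mul_div_comm, Real.mul_self_sqrt (by norm_num), one_mul]
    rw [Finset.prod_mul_distrib, h2]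
    ring
  have hsum : ∀ v v' : Bits N, ∑ w : Bits N, (if readout S w = readout S y then
      ∏ q, (layerEntry m q (w q) (v q) * layerEntry m q (w q) (v' q)) else 0) =
      (1 / 2) ^ (hadamardPart m S).card * (chi y (bxor v v') *
        ((if bxor v v' ∈ masks m S then 1 else 0) * agrees m S y v)) := by
    intro v v'
    have h := sum_prod_bits (N := N) fun q b => (if q ∈ S → b = y q then 1 else 0) *
      (layerEntry m q b (v q) * layerEntry m q b (v' q))
    simp only [sum_layerEntry_mul] at h
    rw [Finset.prod_mul_distrib, Finset.prod_mul_distrib, Finset.prod_mul_distrib, prod_indicator,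
      prod_indicator, prod_hadamardPart] at h
    refine Eq.trans (Finset.sum_congr rfl fun w _ => ?_) (h.trans ?_)
    · rw [Finset.prod_mul_distrib (f := fun q => if q ∈ S → w q = y q then (1 : ℝ) else 0),
        prod_indicator]
      simp only [readout_eq_iff]
      split_ifs <;> simp
    · rw [mul_assoc]
      simp [chi, bxor, masks, agrees]
  -- With `v' = bxor v T`, the sum over `v'` becomes the Walsh coefficient around `v`.
  have hre : ∀ v, ∑ v', (1 / 2 : ℝ) ^ (N - m) * (occurs m C v * occurs m C v') *
      ((1 / 2) ^ (hadamardPart m S).card * (chi y (bxor v v') *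
        ((if bxor v v' ∈ masks m S then 1 else 0) * agrees m S y v))) =
      (1 / 2) ^ (N - m) * (1 / 2) ^ (hadamardPart m S).card *
        (occurs m C v * agrees m S y v * walsh m C S v y) := by
    intro v
    rw [← sum_bxor_left v, walsh, Finset.mul_sum, Finset.mul_sum, ← Finset.sum_filter_add_sum_filter_not
      Finset.univ (fun T => T ∈ masks m S)]
    rw [Finset.sum_eq_zero (s := Finset.univ.filter fun T => T ∉ masks m S), add_zero,
      Finset.filter_mem_eq_inter, Finset.univ_inter]
    · refine Finset.sum_congr rfl fun T hT => ?_
      rw [bxor_self_left, if_pos hT]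
      ring
    · intro T hT
      rw [bxor_self_left, if_neg (Finset.mem_filter.1 hT).2]
      ring
  have hw : ∀ w, (if readout S w = readout S y then outputProb m C w else 0) =
      ∑ v, ∑ v', (1 / 2) ^ (N - m) * (occurs m C v * occurs m C v') *
        if readout S w = readout S y then
          ∏ q, (layerEntry m q (w q) (v q) * layerEntry m q (w q) (v' q)) else 0 := by
    intro w
    split_ifs
    · exact hout w
    · simp
  rw [marginalProb, Finset.sum_filter, Finset.mul_sum]
  simp only [← hre, ← hsum, hw, Finset.mul_sum]
  rw [Finset.sum_comm]
  exact Finset.sum_congr rfl fun v _ => Finset.sum_comm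

end
/-! ### The weights of the algorithm are squares of Walsh coefficients -/

section

variable {N : ℕ} {m : ℕ} {C : Circuit N} {S : Finset (Fin N)}

theorem rank_eq_card (S : Finset (Fin N)) (j : ℕ) :
    rank S j = (S.filter fun q : Fin N => (q : ℕ) < j).card := by
  rw [rank, ← Finset.card_map Fin.valEmbedding]
  congr 1
  ext q
  simp only [Finset.mem_filter, Finset.mem_range, Finset.mem_map, Fin.valEmbedding_apply]
  constructor
  · rintro ⟨h1, h2⟩
    have hq : q < N := by
      by_contra h
      simp [bit, h] at h2
    exact ⟨⟨q, hq⟩, ⟨by simpa [bit_of_lt _ hq, charBits] using h2, h1⟩, rfl⟩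
  · rintro ⟨i, ⟨h1, h2⟩, rfl⟩
    exact ⟨h2, by simp [bit_val, charBits, h1]⟩

theorem card_hadamardPart : (hadamardPart m S).card = rank S (N - m) := by
  rw [rank_eq_card, hadamardPart]

theorem rank_lt {q : Fin N} {j : ℕ} (hq : q ∈ S) (h : (q : ℕ) < j) : rank S q < rank S j := by
  rw [rank_eq_card, rank_eq_card]
  refine Finset.card_lt_card (Finset.ssubset_iff_of_subset (fun i hi => ?_) |>.2 ⟨q, ?_, ?_⟩)
  · simp only [Finset.mem_filter] at hi ⊢
    exact ⟨hi.1, by omega⟩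
  · simp [hq, h]
  · simp

theorem rank_injOn : Set.InjOn (fun q : Fin N => rank S q) S := by
  intro q hq q' hq' h
  rcases lt_trichotomy q q' with hl | hl | hl
  · exact absurd h (rank_lt hq hl).ne
  · exact hl
  · exact absurd h (rank_lt hq' hl).ne'

/-- Ranks number the Hadamard qubits of `S` without gaps from 0 on, so the masks correspond to the
numbers below a power of 2. -/
theorem image_rank :
    (hadamardPart m S).image (fun q : Fin N => rank S q) = Finset.range (rank S (N - m)) := by
  refine Finset.eq_of_subset_of_card_le (fun j hj => ?_) ?_
  · obtain ⟨q, hq, rfl⟩ := Finset.mem_image.1 hj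
    rw [hadamardPart, Finset.mem_filter] at hq
    exact Finset.mem_range.2 (rank_lt hq.1 hq.2)
  · rw [Finset.card_range, Finset.card_image_of_injOn, card_hadamardPart]
    exact rank_injOn.mono fun q hq => (Finset.mem_filter.1 hq).1

theorem mask_apply (τ : ℕ) (q : Fin N) :
    mask m S τ q = (decide (q ∈ hadamardPart m S) && τ.testBit (rank S q)) := by
  simp [mask, charBits, hadamardPart, Bool.and_comm, Bool.and_assoc]

theorem mask_injOn : Set.InjOn (mask m S) (Finset.range (2 ^ rank S (N - m)) : Finset ℕ) := by
  intro τ hτ τ' hτ' h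
  rw [Finset.mem_coe, Finset.mem_range] at hτ hτ'
  refine Nat.eq_of_testBit_eq fun j => ?_
  by_cases hj : j < rank S (N - m)
  · rw [← Finset.mem_range, ← image_rank, Finset.mem_image] at hj
    obtain ⟨q, hq, rfl⟩ := hj
    simpa [mask_apply, hq] using congrFun h q
  · rw [Nat.testBit_lt_two_pow (hτ.trans_le (Nat.pow_le_pow_right (by omega) (by omega))),
      Nat.testBit_lt_two_pow (hτ'.trans_le (Nat.pow_le_pow_right (by omega) (by omega)))]

theorem image_mask : (Finset.range (2 ^ rank S (N - m))).image (mask m S) = masks m S := by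
  refine Finset.eq_of_subset_of_card_le (fun T hT => ?_) ?_
  · obtain ⟨τ, _, rfl⟩ := Finset.mem_image.1 hT
    simp only [masks, Finset.mem_filter, Finset.mem_univ, true_and]
    intro q hq
    rw [mask_apply] at hq
    simpa using (Bool.and_eq_true_iff.1 hq).1
  · rw [Finset.card_image_of_injOn mask_injOn, Finset.card_range]
    have := card_masks (m := m) (S := S)
    rw [card_hadamardPart] at this
    exact_mod_cast this.le

theorem sum_mask (f : Bits N → ℝ) :
    ∑ τ ∈ Finset.range (2 ^ rank S (N - m)), f (mask m S τ) = ∑ T ∈ masks m S, f T := by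
  rw [← image_mask, Finset.sum_image mask_injOn]

theorem chi_mask (ζ τ : ℕ) : chi (mask m S ζ) (mask m S τ) =
    if parity (rank S (N - m)) ζ τ then -1 else 1 := by
  have h : (Finset.univ.filter fun q => (mask m S ζ q && mask m S τ q) = true).card =
      ((Finset.range (rank S (N - m))).filter fun j => ζ.testBit j && τ.testBit j).card := by
    rw [← image_rank, Finset.filter_image, Finset.card_image_of_injOn]
    · congr 1
      ext q
      simp only [mask_apply, Finset.mem_filter, Finset.mem_univ, true_and, Bool.and_eq_true,
        decide_eq_true_eq]
      tauto
    · exact rank_injOn.mono fun q hq =>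
        (Finset.mem_filter.1 (Finset.mem_filter.1 hq).1).1
  rw [chi, Finset.prod_ite, Finset.prod_const, Finset.prod_const_one, mul_one, h, parity]
  rcases Nat.even_or_odd ((Finset.range (rank S (N - m))).filter
    fun j => ζ.testBit j && τ.testBit j).card with h | h
  · rw [h.neg_one_pow, Nat.even_iff.1 h]; simp
  · rw [h.neg_one_pow, Nat.odd_iff.1 h]; simp

theorem walsh_mask (u : Bits N) (ζ : ℕ) : walsh m C S u (mask m S ζ) =
    parityCount (rank S (N - m)) (good m C S u) ζ false -
      parityCount (rank S (N - m)) (good m C S u) ζ true := by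
  rw [walsh, ← sum_mask, parityCount, parityCount, Finset.card_filter, Finset.card_filter]
  push_cast
  rw [← Finset.sum_sub_distrib]
  refine Finset.sum_congr rfl fun τ _ => ?_
  rw [chi_mask, occurs, good]
  cases parity (rank S (N - m)) ζ τ <;>
    cases ancillaZero m (C.perm.symm (bxor u (mask m S τ))) <;> simp

/-- One of the two truncated differences is 0, so their sum is the absolute value of the Walsh
coefficient. -/
theorem weight_eq (u : Bits N) (ζ : ℕ) :
    (weight (rank S (N - m)) (good m C S u) ζ : ℝ) = walsh m C S u (mask m S ζ) ^ 2 := by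
  rw [walsh_mask, weight]
  rcases le_total (parityCount (rank S (N - m)) (good m C S u) ζ false)
    (parityCount (rank S (N - m)) (good m C S u) ζ true) with h | h
  · rw [Nat.sub_eq_zero_of_le h]
    push_cast [Nat.cast_sub h]
    ring
  · rw [Nat.sub_eq_zero_of_le h]
    push_cast [Nat.cast_sub h]
    ring

theorem total_eq (u : Bits N) : (total (rank S (N - m)) (good m C S u) : ℝ) =
    2 ^ rank S (N - m) * cosetCount m C S u := by
  rw [total]
  push_cast
  simp only [weight_eq]
  rw [sum_mask fun T => walsh m C S u T ^ 2, sum_walsh_sq, card_hadamardPart]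

theorem total_pos {u : Bits N} (h : ancillaZero m (C.perm.symm u) = true) :
    0 < total (rank S (N - m)) (good m C S u) := by
  have := total_eq (m := m) (C := C) (S := S) u
  have h' := cosetCount_pos (S := S) h
  have h2 : (0 : ℝ) < total (rank S (N - m)) (good m C S u) := by rw [this]; positivity
  exact_mod_cast h2

theorem rank_le (j : ℕ) : rank S j ≤ S.card := by
  rw [rank_eq_card]
  exact Finset.card_le_card (Finset.filter_subset _ _)

/-- By Parseval the total is the number of masks times the size of the coset, and neither exceeds `2
^ N`. -/
theorem total_le (u : Bits N) : (total (rank S (N - m)) (good m C S u) : ℝ) ≤ 4 ^ N := by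
  have hr : rank S (N - m) ≤ N := (rank_le _).trans (by simpa using Finset.card_le_univ S)
  have hc : cosetCount m C S u ≤ 2 ^ N := by
    refine (Finset.sum_le_sum fun T _ => occurs_le_one _).trans ?_
    rw [Finset.sum_const, nsmul_one, card_masks, card_hadamardPart]
    exact pow_le_pow_right₀ (by norm_num) hr
  rw [total_eq, show (4 : ℝ) = 2 * 2 by norm_num, mul_pow]
  exact mul_le_mul (pow_le_pow_right₀ (by norm_num) hr) hc
    (Finset.sum_nonneg fun T _ => occurs_nonneg _) (by positivity)

theorem ancillaZero_coinInput {P : ℕ} (ρ : Bits P) : ancillaZero m (coinInput m ρ : Bits N) = true :=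
  ancillaZero_iff.2 fun q hq => by simp [coinInput, Nat.not_lt.2 hq]

/-- The basis states that occur are equally likely. -/
theorem sum_coinInput (hm : m ≤ N) (f : Bits N → ℝ) :
    (1 / 2) ^ N * ∑ x : Bits N, f (C.perm (coinInput m x)) =
      (1 / 2) ^ (N - m) * ∑ v, occurs m C v * f v := by
  -- The last `m` coin flips are ignored, so every admissible input arises from `2 ^ m` coin
  -- strings.
  have hfib : ∀ w : Bits N, (∑ x : Bits N, if coinInput m x = w then (1 : ℝ) else 0) =
      2 ^ m * if ancillaZero m w then 1 else 0 := by
    intro w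
    have h := sum_prod_bits (N := N) fun q b =>
      if (decide ((q : ℕ) < N - m) && b) = w q then 1 else 0
    simp only [prod_indicator] at h
    refine Eq.trans (Finset.sum_congr rfl fun x _ => ?_) (h.trans ?_)
    · simp only [funext_iff, coinInput, bit_val]
    · have h2 : ∀ q : Fin N, ((if (decide ((q : ℕ) < N - m) && true) = w q then (1 : ℝ) else 0) +
          if (decide ((q : ℕ) < N - m) && false) = w q then 1 else 0) =
          (if (q : ℕ) < N - m then 1 else 2) *
            if N - m ≤ (q : ℕ) → w q = false then 1 else 0 := by
        intro q
        by_cases hq : (q : ℕ) < N - m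
        · cases hw : w q <;> simp [hq, Nat.not_le.2 hq]
        · cases hw : w q <;> simp [hq, Nat.not_lt.1 hq]; norm_num
      simp only [h2, Finset.prod_mul_distrib, prod_indicator, ancillaZero_iff]
      congr 1
      rw [Finset.prod_ite, Finset.prod_const, Finset.prod_const, one_pow, one_mul]
      congr 1
      have h3 := Finset.card_filter_add_card_filter_not (s := (Finset.univ : Finset (Fin N)))
        fun q => (q : ℕ) < N - m
      have h4 := Fin.card_filter_val_lt (n := N) (m := N - m)
      rw [h4, Finset.card_univ, Fintype.card_fin] at h3
      omega
  have h1 : ∑ x : Bits N, f (C.perm (coinInput m x)) =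
      ∑ w : Bits N, ∑ x : Bits N, if coinInput m x = w then f (C.perm w) else 0 := by
    rw [Finset.sum_comm]
    simp
  have h2 : ∀ w : Bits N, (∑ x : Bits N, if coinInput m x = w then f (C.perm w) else 0) =
      2 ^ m * ((if ancillaZero m w then 1 else 0) * f (C.perm w)) := by
    intro w
    rw [← mul_assoc, ← hfib, Finset.sum_mul]
    simp
  rw [h1]
  simp only [h2]
  rw [← Finset.mul_sum, ← mul_assoc, ← Equiv.sum_comp C.perm fun v => occurs m C v * f v]
  simp only [occurs, Equiv.symm_apply_apply]
  congr 1
  nth_rewrite 1 [← Nat.sub_add_cancel hm]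
  rw [pow_add, mul_assoc, ← mul_pow]
  norm_num

theorem sum_sampleBits (u : Bits N) (y : Bits N) :
    (∑ ζ ∈ Finset.range (2 ^ rank S (N - m)),
      if readout S (sampleBits m S u ζ) = readout S y then
        (weight (rank S (N - m)) (good m C S u) ζ : ℝ) / total (rank S (N - m)) (good m C S u)
      else 0) = (1 / 2) ^ (hadamardPart m S).card *
        (agrees m S y u * (walsh m C S u y ^ 2 / cosetCount m C S u)) := by
  -- Only the part of `y` on the Hadamard qubits of `S` enters the characters, and exactly one `ζ`
  -- below the bound has this part as its mask.
  let y' : Bits N := fun q => y q && decide (q ∈ hadamardPart m S)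
  have hy' : y' ∈ masks m S := by
    simp only [masks, Finset.mem_filter, Finset.mem_univ, true_and]
    intro q hq
    simpa using (Bool.and_eq_true_iff.1 hq).2
  have hw : walsh m C S u y' = walsh m C S u y := by
    refine Finset.sum_congr rfl fun T hT => ?_
    congr 1
    refine Finset.prod_congr rfl fun q _ => ?_
    simp only [masks, Finset.mem_filter, Finset.mem_univ, true_and] at hT
    by_cases h : T q = true
    · simp [y', h, hT q h]
    · simp [h]
  have hiff : ∀ ζ, readout S (sampleBits m S u ζ) = readout S y ↔
      (∀ q ∈ S, N - m ≤ (q : ℕ) → u q = y q) ∧ mask m S ζ = y' := by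
    intro ζ
    rw [readout_eq_iff]
    constructor
    · intro h
      refine ⟨fun q hq hm => ?_, funext fun q => ?_⟩
      · have := h q hq
        simpa [sampleBits, Nat.not_lt.2 hm] using this
      · rw [mask_apply]
        by_cases hq : q ∈ hadamardPart m S
        · have := Finset.mem_filter.1 hq
          have h' := h q this.1
          simpa [sampleBits, this.2, y', hq] using h'
        · simp [hq, y']
    · rintro ⟨h1, h2⟩ q hq
      by_cases hm : (q : ℕ) < N - m
      · have hh : q ∈ hadamardPart m S := Finset.mem_filter.2 ⟨hq, hm⟩
        have := congrFun h2 q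
        rw [mask_apply] at this
        simpa [sampleBits, hm, y', hh] using this
      · simpa [sampleBits, hm] using h1 q hq (Nat.not_lt.1 hm)
  simp only [hiff, weight_eq, total_eq]
  rw [sum_mask fun T => if (∀ q ∈ S, N - m ≤ (q : ℕ) → u q = y q) ∧ T = y' then
    walsh m C S u T ^ 2 / (2 ^ rank S (N - m) * cosetCount m C S u) else 0]
  rw [Finset.sum_eq_single_of_mem y' hy' fun T _ hT => if_neg fun h => hT h.2, hw, agrees,
    card_hadamardPart]
  simp only [and_true]
  split_ifs
  · rw [one_mul, one_div, inv_pow, div_mul_eq_div_div]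
    field_simp
  · simp

/-- The classical procedure with an ideal choice of `ζ` reproduces the quantum distribution exactly;
what remains is the rounding of that choice. -/
theorem marginalProb_eq (hm : m ≤ N) (z : Bits S.card) :
    marginalProb m C S z = (1 / 2) ^ N * ∑ x : Bits N,
      ∑ ζ ∈ Finset.range (2 ^ rank S (N - m)),
        if readout S (sampleBits m S (C.perm (coinInput m x)) ζ) = z then
          (weight (rank S (N - m)) (good m C S (C.perm (coinInput m x))) ζ : ℝ) /
            total (rank S (N - m)) (good m C S (C.perm (coinInput m x)))
        else 0 := by
  obtain ⟨y, rfl⟩ := exists_readout_eq z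
  simp only [sum_sampleBits]
  rw [sum_coinInput hm fun u => (1 / 2) ^ (hadamardPart m S).card *
        (agrees m S y u * (walsh m C S u y ^ 2 / cosetCount m C S u)),
    marginalProb_readout hm, sum_walsh_eq, mul_assoc, Finset.mul_sum]
  congr 1
  exact Finset.sum_congr rfl fun v _ => by ring

end
/-! ### Sampling with coin flips -/

/-- The number with the binary digits `b 0, b 1, …, b (j - 1)`. -/
def digits (b : ℕ → Bool) : ℕ → ℕ
  | 0 => 0
  | j + 1 => 2 * digits b j + if b j then 1 else 0

theorem digitsMod_eq {D : ℕ} (hD : 0 < D) (b : ℕ → Bool) (j : ℕ) :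
    digitsMod D b j = digits b j % D := by
  induction j with
  | zero => simp [digitsMod, digits]
  | succ j ih =>
    have hlt := digitsMod_lt hD b j
    have h : digits b (j + 1) % D = (2 * digitsMod D b j + if b j then 1 else 0) % D := by
      rw [ih, digits, Nat.add_mod, Nat.mul_mod]
      conv_rhs => rw [Nat.add_mod, Nat.mul_mod, Nat.mod_mod]
    have hc : (if b j then 1 else 0) ≤ 1 := by split_ifs <;> omega
    rw [h, digitsMod]
    simp only [decide_eq_true_eq]
    generalize (if b j then 1 else 0) = c at hc
    split_ifs with h1
    · rw [Nat.mod_eq_sub_mod h1, Nat.mod_eq_of_lt (by omega)]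
    · rw [Nat.mod_eq_of_lt (by omega)]

theorem digits_congr {b b' : ℕ → Bool} {j : ℕ} (h : ∀ i < j, b i = b' i) :
    digits b j = digits b' j := by
  induction j with
  | zero => rfl
  | succ j ih => rw [digits, digits, ih fun i hi => h i (by omega), h j (by omega)]

/-- The flips form a uniform number below `2 ^ l`. The induction splits off the last, least
significant digit, separating even from odd numbers. -/
theorem sum_digits (l : ℕ) (f : ℕ → ℝ) :
    ∑ x : Bits l, f (digits (bit x) l) = ∑ t ∈ Finset.range (2 ^ l), f t := by
  induction l generalizing f with
  | zero => simp [digits]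
  | succ l ih =>
    have hd : ∀ (c : Bool) (x : Bits l), digits (bit (Fin.snoc x c : Bits (l + 1))) (l + 1) =
        2 * digits (bit x) l + if c then 1 else 0 := by
      intro c x
      rw [digits]
      congr 1
      · congr 1
        refine digits_congr fun i hi => ?_
        rw [bit_of_lt _ (by omega), bit_of_lt _ hi]
        exact Fin.snoc_castSucc (α := fun _ => Bool) c x ⟨i, hi⟩
      · rw [bit_of_lt _ (Nat.lt_succ_self l)]
        have : (Fin.snoc x c : Bits (l + 1)) ⟨l, Nat.lt_succ_self l⟩ = c :=
          Fin.snoc_last (α := fun _ => Bool) c x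
        rw [this]
    have hr : ∀ K, ∑ t ∈ Finset.range (2 * K), f t =
        ∑ t ∈ Finset.range K, (f (2 * t) + f (2 * t + 1)) := by
      intro K
      induction K with
      | zero => simp
      | succ K ih =>
        rw [show 2 * (K + 1) = 2 * K + 1 + 1 by ring, Finset.sum_range_succ, Finset.sum_range_succ,
          ih, Finset.sum_range_succ, add_assoc]
    rw [← Equiv.sum_comp (Fin.snocEquiv fun _ : Fin (l + 1) => Bool), Fintype.sum_prod_type, pow_succ,
      mul_comm (2 ^ l), hr, ← ih fun t => f (2 * t) + f (2 * t + 1), Fintype.sum_bool,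
      Finset.sum_add_distrib, add_comm]
    congr 1 <;> refine Finset.sum_congr rfl fun x _ => ?_
    · exact congrArg f (hd false x)
    · exact congrArg f (hd true x)

/-- The partial sums are monotone, so those that are at most `R` belong to an initial segment, whose
length is the index of the interval containing `R`. -/
theorem select_eq_iff {a : ℕ} {g : ℕ → Bool} {R ζ : ℕ} (hR : R < total a g) (hζ : ζ < 2 ^ a) :
    select a g R = ζ ↔ ∑ ζ' ∈ Finset.range ζ, weight a g ζ' ≤ R ∧
      R < ∑ ζ' ∈ Finset.range (ζ + 1), weight a g ζ' := by
  have hmono : ∀ {i j : ℕ}, i ≤ j → ∑ ζ' ∈ Finset.range i, weight a g ζ' ≤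
      ∑ ζ' ∈ Finset.range j, weight a g ζ' := fun h =>
    Finset.sum_le_sum_of_subset (Finset.range_mono h)
  have key : ∀ ζ < 2 ^ a, ∑ ζ' ∈ Finset.range ζ, weight a g ζ' ≤ R →
      R < ∑ ζ' ∈ Finset.range (ζ + 1), weight a g ζ' → select a g R = ζ := by
    intro ζ hζ h1 h2
    have : ((Finset.range (2 ^ a)).filter fun ζ =>
        decide (∑ ζ' ∈ Finset.range (ζ + 1), weight a g ζ' ≤ R) = true) = Finset.range ζ := by
      ext i
      simp only [Finset.mem_filter, Finset.mem_range, decide_eq_true_eq]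
      constructor
      · rintro ⟨_, h⟩
        by_contra hi
        have := hmono (show ζ + 1 ≤ i + 1 by omega)
        omega
      · intro hi
        exact ⟨by omega, (hmono (show i + 1 ≤ ζ by omega)).trans h1⟩
    rw [select, this, Finset.card_range]
  refine ⟨fun h => ?_, fun h => key ζ hζ h.1 h.2⟩
  have hex : ∃ j, R < ∑ ζ' ∈ Finset.range (j + 1), weight a g ζ' :=
    ⟨2 ^ a, hR.trans_le (hmono (by omega))⟩
  classical
  have hj := Nat.find_spec hex
  have hj' : ∑ ζ' ∈ Finset.range (Nat.find hex), weight a g ζ' ≤ R := by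
    rcases h0 : Nat.find hex with _ | i
    · simp
    · exact not_lt.1 (Nat.find_min hex (m := i) (by omega))
  have hlt : Nat.find hex < 2 ^ a := by
    by_contra hc
    have := hmono (not_lt.1 hc)
    rw [total] at hR
    omega
  obtain rfl : Nat.find hex = ζ := by rw [← key _ hlt hj' hj, h]
  exact ⟨hj', hj⟩

theorem select_lt {a : ℕ} {g : ℕ → Bool} {R : ℕ} (hR : R < total a g) : select a g R < 2 ^ a := by
  by_contra hc
  have h1 : select a g R ≤ 2 ^ a := by
    rw [select]
    exact (Finset.card_filter_le _ _).trans (Finset.card_range _).le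
  have h2 : ((Finset.range (2 ^ a)).filter fun ζ =>
      decide (∑ ζ' ∈ Finset.range (ζ + 1), weight a g ζ' ≤ R) = true) = Finset.range (2 ^ a) :=
    Finset.eq_of_subset_of_card_le (Finset.filter_subset _ _) (by
      rw [Finset.card_range]; exact not_lt.1 hc)
  have h3 : 2 ^ a - 1 ∈ Finset.range (2 ^ a) :=
    Finset.mem_range.2 (Nat.sub_lt (by positivity) one_pos)
  rw [← h2, Finset.mem_filter, decide_eq_true_eq,
    Nat.sub_add_cancel (Nat.one_le_two_pow)] at h3
  exact absurd h3.2 (not_le.2 hR)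

/-- Each residue occurs `K / D` times, rounded down, or once more. -/
theorem abs_count_mod_sub_le {D R : ℕ} (hR : R < D) (K : ℕ) :
    |(((Finset.range K).filter fun t => t % D = R).card : ℝ) - K / D| ≤ 1 := by
  have hD : 0 < D := by omega
  have h := Nat.count_modEq_card K hD R
  rw [Nat.count_eq_card_filter_range] at h
  simp only [Nat.ModEq, Nat.mod_eq_of_lt hR] at h
  rw [h]
  have h1 := Nat.div_add_mod K D
  have h2 := Nat.mod_lt K hD
  have h3 : (K : ℝ) / D = (K / D : ℕ) + (K % D : ℕ) / D := by
    have hD' : (D : ℝ) ≠ 0 := by positivity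
    field_simp
    exact_mod_cast h1.symm
  have h4 : ((K % D : ℕ) : ℝ) / D ≤ 1 := by
    rw [div_le_one (by positivity)]
    exact_mod_cast h2.le
  have h5 : (0 : ℝ) ≤ ((K % D : ℕ) : ℝ) / D := by positivity
  rw [h3, abs_le]
  split_ifs <;> push_cast <;> constructor <;> linarith

/-- With `K` equally likely numbers, the algorithm selects `ζ` with a probability close to the
right one. -/
theorem abs_weight_sub_le {a : ℕ} {g : ℕ → Bool} {ζ : ℕ} (hζ : ζ < 2 ^ a) (hD : 0 < total a g)
    {K : ℕ} (hK : 0 < K) : |(weight a g ζ : ℝ) / total a g -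
      ((Finset.range K).filter fun t => select a g (t % total a g) = ζ).card / K| ≤
        weight a g ζ / K := by
  have hsub : ∑ ζ' ∈ Finset.range (ζ + 1), weight a g ζ' ≤ total a g :=
    Finset.sum_le_sum_of_subset (Finset.range_mono hζ)
  -- Sort by residues: `ζ` is selected by as many residues as its weight, and each of them is off by
  -- at most 1.
  have hcount : ((Finset.range K).filter fun t => select a g (t % total a g) = ζ).card =
      ∑ R ∈ Finset.Ico (∑ ζ' ∈ Finset.range ζ, weight a g ζ')
        (∑ ζ' ∈ Finset.range (ζ + 1), weight a g ζ'),
        ((Finset.range K).filter fun t => t % total a g = R).card := by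
    rw [Finset.card_eq_sum_card_fiberwise (f := fun t => t % total a g)
      (t := Finset.Ico (∑ ζ' ∈ Finset.range ζ, weight a g ζ')
        (∑ ζ' ∈ Finset.range (ζ + 1), weight a g ζ'))]
    · refine Finset.sum_congr rfl fun R hR => ?_
      congr 1
      ext t
      simp only [Finset.mem_filter, and_assoc]
      refine and_congr_right fun _ => ⟨fun h => h.2, fun h => ⟨?_, h⟩⟩
      rw [h]
      have := Finset.mem_Ico.1 hR
      exact (select_eq_iff (by omega) hζ).2 this
    · intro t ht
      have := (Finset.mem_filter.1 ht).2
      exact Finset.mem_coe.2 (Finset.mem_Ico.2 ((select_eq_iff (Nat.mod_lt _ hD) hζ).1 this))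
  have hcard : (Finset.Ico (∑ ζ' ∈ Finset.range ζ, weight a g ζ')
      (∑ ζ' ∈ Finset.range (ζ + 1), weight a g ζ')).card = weight a g ζ := by
    rw [Nat.card_Ico, Finset.sum_range_succ, Nat.add_sub_cancel_left]
  have hK' : (0 : ℝ) < K := by exact_mod_cast hK
  have hD' : (0 : ℝ) < total a g := by exact_mod_cast hD
  have h1 : |∑ R ∈ Finset.Ico (∑ ζ' ∈ Finset.range ζ, weight a g ζ')
      (∑ ζ' ∈ Finset.range (ζ + 1), weight a g ζ'),
      ((((Finset.range K).filter fun t => t % total a g = R).card : ℝ) - K / total a g)| ≤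
        weight a g ζ := by
    refine (Finset.abs_sum_le_sum_abs _ _).trans ((Finset.sum_le_card_nsmul _ _ 1
      fun R hR => ?_).trans (by rw [hcard]; simp))
    have := Finset.mem_Ico.1 hR
    exact abs_count_mod_sub_le (by omega) K
  rw [Finset.sum_sub_distrib, Finset.sum_const, hcard, nsmul_eq_mul] at h1
  rw [hcount, abs_sub_comm]
  push_cast
  have h2 : (∑ R ∈ Finset.Ico (∑ ζ' ∈ Finset.range ζ, weight a g ζ')
      (∑ ζ' ∈ Finset.range (ζ + 1), weight a g ζ'),
      (((Finset.range K).filter fun t => t % total a g = R).card : ℝ)) / K -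
        weight a g ζ / total a g = (∑ R ∈ Finset.Ico (∑ ζ' ∈ Finset.range ζ, weight a g ζ')
      (∑ ζ' ∈ Finset.range (ζ + 1), weight a g ζ'),
      (((Finset.range K).filter fun t => t % total a g = R).card : ℝ) -
        weight a g ζ * (K / total a g)) / K := by
    field_simp
  rw [h2, abs_div, abs_of_pos hK']
  exact div_le_div_of_nonneg_right h1 hK'.le

section

variable {N : ℕ} {m : ℕ} {C : Circuit N} {S : Finset (Fin N)}

/-- The first `N` flips determine the input of the circuit, the last `l` the choice of `ζ`. The form
matches `marginalProb_eq` term by term. -/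
theorem coinProb_sample (l : ℕ) (z : Bits S.card) :
    coinProb (fun ρ : Bits (N + l) => readout S (sample m C S ρ)) z =
      (1 / 2) ^ N * ∑ x : Bits N, ∑ ζ ∈ Finset.range (2 ^ rank S (N - m)),
        if readout S (sampleBits m S (C.perm (coinInput m x)) ζ) = z then
          (((Finset.range (2 ^ l)).filter fun t => select (rank S (N - m))
            (good m C S (C.perm (coinInput m x))) (t % total (rank S (N - m))
              (good m C S (C.perm (coinInput m x)))) = ζ).card : ℝ) / (2 ^ l : ℕ)
        else 0 := by
  have hs : ∀ (x : Bits N) (y : Bits l), sample m C S (Fin.append x y) =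
      sampleBits m S (C.perm (coinInput m x)) (select (rank S (N - m))
        (good m C S (C.perm (coinInput m x))) (digits (bit y) l % total (rank S (N - m))
              (good m C S (C.perm (coinInput m x))))) := by
    intro x y
    have h1 : (coinInput m (Fin.append x y) : Bits N) = coinInput m x := by
      funext q
      rw [coinInput, coinInput, bit_val, bit_of_lt _ (by omega)]
      congr 1
      exact Fin.append_left x y q
    have hp : 0 < total (rank S (N - m)) (good m C S (C.perm (coinInput m x))) :=
      total_pos (by rw [Equiv.symm_apply_apply]; exact ancillaZero_coinInput x)
    rw [sample, h1, digitsMod_eq hp, Nat.add_sub_cancel_left]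
    congr 3
    refine digits_congr fun i hi => ?_
    rw [bit_of_lt _ (by omega), bit_of_lt _ hi]
    exact Fin.append_right x y ⟨i, hi⟩
  have hx : ∀ x : Bits N, (∑ y : Bits l,
      if readout S (sample m C S (Fin.append x y)) = z then (1 : ℝ) else 0) =
      ∑ ζ ∈ Finset.range (2 ^ rank S (N - m)),
        if readout S (sampleBits m S (C.perm (coinInput m x)) ζ) = z then
          (((Finset.range (2 ^ l)).filter fun t => select (rank S (N - m))
            (good m C S (C.perm (coinInput m x))) (t % total (rank S (N - m))
              (good m C S (C.perm (coinInput m x)))) = ζ).card : ℝ) else 0 := by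
    intro x
    have hp : 0 < total (rank S (N - m)) (good m C S (C.perm (coinInput m x))) :=
      total_pos (by rw [Equiv.symm_apply_apply]; exact ancillaZero_coinInput x)
    simp only [hs]
    rw [sum_digits l fun t => if readout S (sampleBits m S (C.perm (coinInput m x))
      (select (rank S (N - m)) (good m C S (C.perm (coinInput m x))) (t % total (rank S (N - m))
        (good m C S (C.perm (coinInput m x)))))) = z then (1 : ℝ) else 0]
    rw [← Finset.sum_fiberwise_of_maps_to (t := Finset.range (2 ^ rank S (N - m)))
      fun t _ => Finset.mem_range.2 (select_lt (Nat.mod_lt t hp))]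
    refine Finset.sum_congr rfl fun ζ _ => ?_
    rw [Finset.sum_congr rfl (g := fun _ => if readout S (sampleBits m S
      (C.perm (coinInput m x)) ζ) = z then (1 : ℝ) else 0) fun t ht => by
        rw [(Finset.mem_filter.1 ht).2], Finset.sum_const]
    split_ifs <;> simp
  rw [coinProb, Finset.card_filter]
  push_cast
  rw [← Equiv.sum_comp (Fin.appendEquiv N l), Fintype.sum_prod_type, pow_add, one_div, inv_pow,
    Finset.sum_div, Finset.mul_sum]
  refine Finset.sum_congr rfl fun x _ => ?_
  refine (congrArg (· / (2 ^ N * 2 ^ l)) (hx x)).trans ?_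
  rw [Finset.sum_div, Finset.mul_sum]
  refine Finset.sum_congr rfl fun ζ _ => ?_
  split_ifs
  · field_simp
  · simp

/-- The output distribution of the algorithm is close to that of the quantum circuit. -/
theorem sum_abs_marginalProb_sub_le (hm : m ≤ N) (l : ℕ) :
    ∑ z, |marginalProb m C S z -
      coinProb (fun ρ : Bits (N + l) => readout S (sample m C S ρ)) z| ≤ 4 ^ N / 2 ^ l := by
  set P : Bits N → ℕ → ℝ := fun x ζ =>
    (weight (rank S (N - m)) (good m C S (C.perm (coinInput m x))) ζ : ℝ) /
      total (rank S (N - m)) (good m C S (C.perm (coinInput m x))) with hP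
  set Q : Bits N → ℕ → ℝ := fun x ζ => (((Finset.range (2 ^ l)).filter fun t =>
    select (rank S (N - m)) (good m C S (C.perm (coinInput m x))) (t % total (rank S (N - m))
      (good m C S (C.perm (coinInput m x)))) = ζ).card : ℝ) / (2 ^ l : ℕ) with hQ
  have h1 : ∀ z, |marginalProb m C S z -
      coinProb (fun ρ : Bits (N + l) => readout S (sample m C S ρ)) z| ≤
      (1 / 2) ^ N * ∑ x : Bits N, ∑ ζ ∈ Finset.range (2 ^ rank S (N - m)),
        if readout S (sampleBits m S (C.perm (coinInput m x)) ζ) = z then |P x ζ - Q x ζ|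
        else 0 := by
    intro z
    rw [marginalProb_eq hm, coinProb_sample, ← mul_sub, abs_mul, abs_of_nonneg (by positivity),
      ← Finset.sum_sub_distrib]
    refine mul_le_mul_of_nonneg_left ((Finset.abs_sum_le_sum_abs _ _).trans
      (Finset.sum_le_sum fun x _ => ?_)) (by positivity)
    rw [← Finset.sum_sub_distrib]
    refine (Finset.abs_sum_le_sum_abs _ _).trans (Finset.sum_le_sum fun ζ _ => ?_)
    split_ifs
    · exact le_rfl
    · simp
  refine (Finset.sum_le_sum fun z _ => h1 z).trans ?_
  rw [← Finset.mul_sum, Finset.sum_comm]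
  have h2 : ∀ x : Bits N, (∑ z : Bits S.card, ∑ ζ ∈ Finset.range (2 ^ rank S (N - m)),
      if readout S (sampleBits m S (C.perm (coinInput m x)) ζ) = z then |P x ζ - Q x ζ|
        else 0) ≤ 4 ^ N / 2 ^ l := by
    intro x
    have hp : 0 < total (rank S (N - m)) (good m C S (C.perm (coinInput m x))) :=
      total_pos (by rw [Equiv.symm_apply_apply]; exact ancillaZero_coinInput x)
    -- Each `ζ` yields a single `z`, so the sum over `z` collapses. The errors `weight / 2 ^ l` then
    -- add up to the total divided by `2 ^ l`.
    rw [Finset.sum_comm]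
    simp only [Finset.sum_ite_eq, Finset.mem_univ, if_true]
    refine (Finset.sum_le_sum fun ζ hζ => abs_weight_sub_le (Finset.mem_range.1 hζ) hp
      (K := 2 ^ l) (by positivity)).trans ?_
    rw [← Finset.sum_div]
    push_cast
    refine div_le_div_of_nonneg_right ?_ (by positivity)
    have := total_le (m := m) (C := C) (S := S) (C.perm (coinInput m x))
    rw [total] at this
    exact_mod_cast this
  refine (mul_le_mul_of_nonneg_left (Finset.sum_le_sum fun x _ => h2 x) (by positivity)).trans ?_
  rw [Finset.sum_const, Finset.card_univ, Fintype.card_fun, Fintype.card_bool, Fintype.card_fin,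
    nsmul_eq_mul, ← mul_assoc]
  push_cast
  rw [← mul_pow]
  norm_num

end
/-! ### The theorem -/

/-- Eventually `2 ^ a ≤ exp (c * log N) = N ^ c`. For the finitely many small `N`, where the
asymptotic bound says nothing about `k N`, the bound `a ≤ N` gives a constant. -/
theorem exists_polynomial_two_pow_le {k : ℕ → ℕ}
    (hk : (fun N : ℕ => (k N : ℝ)) =O[atTop] fun N : ℕ => Real.log N) :
    ∃ D : Polynomial ℕ, ∀ N a : ℕ, a ≤ N → a ≤ k N → 2 ^ a ≤ D.eval N := by
  obtain ⟨c, hc⟩ := hk.bound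
  obtain ⟨N₀, hN₀⟩ := eventually_atTop.1 hc
  refine ⟨Polynomial.X ^ ⌈c⌉₊ + Polynomial.C (2 ^ (N₀ + 1)), fun N a haN hak => ?_⟩
  simp only [Polynomial.eval_add, Polynomial.eval_pow, Polynomial.eval_X, Polynomial.eval_C]
  rcases lt_or_ge N (N₀ + 1) with h | h
  · have : 2 ^ a ≤ 2 ^ (N₀ + 1) := Nat.pow_le_pow_right (by omega) (by omega)
    omega
  · have hN : (1 : ℝ) ≤ N := by exact_mod_cast (show 1 ≤ N by omega)
    have h1 := hN₀ N (by omega)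
    rw [Real.norm_of_nonneg (Nat.cast_nonneg _), Real.norm_of_nonneg (Real.log_nonneg hN)] at h1
    have h2 : (a : ℝ) ≤ ⌈c⌉₊ * Real.log N :=
      (Nat.cast_le.2 hak).trans (h1.trans (mul_le_mul_of_nonneg_right (Nat.le_ceil c)
        (Real.log_nonneg hN)))
    have h3 : (2 : ℝ) ^ a ≤ (N : ℝ) ^ ⌈c⌉₊ := by
      calc (2 : ℝ) ^ a ≤ Real.exp 1 ^ a :=
            pow_le_pow_left₀ (by norm_num) (by linarith [Real.add_one_le_exp 1]) a
        _ = Real.exp a := by rw [← Real.exp_nat_mul, mul_one]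
        _ ≤ Real.exp (⌈c⌉₊ * Real.log N) := Real.exp_le_exp.2 h2
        _ = (N : ℝ) ^ ⌈c⌉₊ := by rw [Real.exp_nat_mul, Real.exp_log (by linarith)]
    have h4 : 2 ^ a ≤ N ^ ⌈c⌉₊ := by exact_mod_cast h3
    exact h4.trans (Nat.le_add_right _ _)

/-- The inputs of the algorithm: the numbers, the set of qubits, and the coin flips. -/
structure SamplingInput (k P : ℕ → ℕ) where
  /-- the number of qubits -/
  N : ℕ
  /-- the number of qubits without Hadamard gates -/
  m : ℕ
  /-- the set of qubits -/
  S : Finset (Fin N)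
  /-- the coin flips -/
  ρ : Bits (P N)
  /-- not more than all qubits are without Hadamard gates -/
  m_le : m ≤ N
  /-- the set of qubits is small -/
  card_le : S.card ≤ k N

/-- Of the flips used for rounding, `2 * N` cancel the factor `4 ^ N`, and the other `R` leave an
error `2 ^ (-R) ≤ 1 / R`. -/
theorem sum_abs_marginalProb_sub_le_one_div {N m P R : ℕ} (C : Circuit N) (S : Finset (Fin N))
    (hm : m ≤ N) (hP : P = N + (2 * N + R)) (hR : 0 < R) :
    ∑ z, |marginalProb m C S z -
      coinProb (fun ρ : Bits P => readout S (sample m C S ρ)) z| ≤ 1 / (R : ℝ) := by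
  subst hP
  refine (sum_abs_marginalProb_sub_le hm _).trans ?_
  have h1 : (R : ℝ) ≤ 2 ^ R := by exact_mod_cast Nat.lt_two_pow_self.le
  have h2 : (0 : ℝ) < R := by exact_mod_cast hR
  rw [pow_add, pow_mul, show (2 : ℝ) ^ 2 = 4 by norm_num, ← div_div, div_self (by positivity)]
  exact one_div_le_one_div_of_le h2 h1

end HCmQ

theorem theorem4 (C : (N m : ℕ) → HCmQ.Circuit N) (hC : HCmQ.PolyTimeUniform C)
    (k : ℕ → ℕ) (hk : (fun N : ℕ => (k N : ℝ)) =O[atTop] fun N : ℕ => Real.log N)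
    (r : Polynomial ℕ) (hr : ∀ N : ℕ, 0 < r.eval N) :
    ∃ (A : HCmQ.Program) (p T : Polynomial ℕ),
      ∀ (N m : ℕ), m ≤ N → ∀ S : Finset (Fin N), S.card ≤ k N →
        ∃ F : HCmQ.Bits (p.eval N) → HCmQ.Bits S.card,
          (∀ ρ : HCmQ.Bits (p.eval N),
            A.ComputesInTime [HCmQ.unary N, HCmQ.unary m, HCmQ.setWord S, HCmQ.word ρ]
              (HCmQ.word (F ρ)) (T.eval N)) ∧
          ∑ z : HCmQ.Bits S.card,
              |HCmQ.marginalProb m (C N m) S z - HCmQ.coinProb F z| ≤ 1 / ((r.eval N : ℕ) : ℝ) := by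
  open HCmQ in
  obtain ⟨G, Tg, hG⟩ := hC
  obtain ⟨D, hD⟩ := exists_polynomial_two_pow_le hk
  let p : Polynomial ℕ := Polynomial.X + (2 * Polynomial.X + r)
  have hp : ∀ N, p.eval N = N + (2 * N + r.eval N) := fun N => by simp [p]
  -- One size that dominates the number of coin flips, the running time of the circuit generator and
  -- the number of masks, so that all bounds needed below are immediate.
  let Q : Polynomial ℕ := p + Tg + D
  have hQ : ∀ N, Q.eval N = p.eval N + Tg.eval N + D.eval N := fun N => by simp [Q]
  let ι := SamplingInput k fun N => p.eval N
  let M : ι → ℕ := fun i => Q.eval i.N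
  let Γ : List (ι → List Bool) :=
    [fun i => unary i.N, fun i => unary i.m, fun i => setWord i.S, fun i => word i.ρ]
  have hbound : ∀ {f : ι → ℕ}, (∀ i, f i ≤ M i) → PolyBounded M f := fun h =>
    PolyBounded.self.mono h
  have hbN : PolyBounded M fun i => (unary i.N).length := hbound fun i => by
    simp only [unary, List.length_replicate, M, hQ, hp]
    omega
  have hN : CompN M Γ fun i => i.N := Comp.var (by simp [Γ]) hbN
  have hm : CompN M Γ fun i => i.m := Comp.var (by simp [Γ]) (hbound fun i => by
    have := i.m_le
    simp only [unary, List.length_replicate, M, hQ, hp]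
    omega)
  have hS : Comp M Γ fun i => setWord i.S := Comp.var (by simp [Γ]) (hbound fun i => by
    simp only [setWord, word, List.length_ofFn, M, hQ, hp]
    omega)
  have hρ : Comp M Γ fun i => word i.ρ := Comp.var (by simp [Γ]) (hbound fun i => by
    simp only [word, List.length_ofFn, M, hQ]
    omega)
  have hE : Comp M Γ fun i => (C i.N i.m).encode :=
    Comp.call hN hm (hbound (f := fun i => Tg.eval i.N) fun i => by
      simp only [M, hQ]
      omega) fun i => hG i.N i.m i.m_le
  have hb : PolyBounded M fun i => 2 ^ rank i.S (i.N - i.m) := hbound fun i => by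
    refine (hD i.N _ ((rank_le _).trans (by simpa using Finset.card_le_univ i.S))
      ((rank_le _).trans i.card_le)).trans ?_
    simp only [M, hQ]
    omega
  have hs : Comp M Γ fun i => word (sample i.m (C i.N i.m) i.S i.ρ) :=
    Comp.sample (C := fun i : ι => C i.N i.m) hN hm hS hE hρ hb fun i =>
      total_pos (by rw [Equiv.symm_apply_apply]; exact ancillaZero_coinInput _)
  obtain ⟨A, T, ⟨K, hK⟩, hA⟩ := (Comp.readout hN hS hs).exists_program hbN
  -- The size of an instance is a polynomial in `N` alone, so the bound from `PolyBounded` is one as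
  -- well.
  refine ⟨A, p, (Q + 2) ^ K, fun N m hmN S hSk =>
    ⟨fun ρ => readout S (sample m (C N m) S ρ), fun ρ => ?_, ?_⟩⟩
  · obtain ⟨t, s, ht, e, h0⟩ := hA ⟨N, m, S, ρ, hmN, hSk⟩
    refine ⟨t, s, ht.trans ((hK _).trans ?_), e, h0⟩
    simp [M]
  · exact sum_abs_marginalProb_sub_le_one_div _ S hmN (hp N) (hr N)
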